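/- Proposition 5.3 (Table 1 census). Let $n\ge 1$ and $d,e,m\ge 0$ be integers. The Taylor variety $\mathcal T^n_{d,e,m}$ is the Zariski closure, in the complex projective space $\mathbb P^{\binom{n+m}{n}-1}$ of nonzero polynomials of degree $\le m$ in $n$ variables $x=(x_1,\dots,x_n)$ up to scaling, of the set of order-$m$ Taylor polynomials at the origin $\sum_{|\gamma|\le m}c_\gamma x^\gamma$ of the rational functions $P/Q$, where $P,Q\in\mathbb C[x]$ satisfy $\deg P\le d$, $\deg Q\le e$ and $P(0)=Q(0)=1$. Put $p=\binom{d+n}{n}+\binom{e+n}{n}-2$ (the number of parameters) and $a=\binom{m+n}{n}-1$ (the dimension of the ambient space). The expected dimension is $\min\{p,a\}$, and $\mathcal T^n_{d,e,m}$ is called defective if $\dim\mathcal T^n_{d,e,m}<\min\{p,a\}$. Among all $(n,d,e,m)$ with $1\le n\le 5$ and $m\le 12-n$, the defective Taylor varieties are exactly those in the following list. An entry $(n;d,e,m)\to(\delta,p,a)$ gives the parameters $n,d,e,m$, the dimension $\delta=\dim\mathcal T^n_{d,e,m}$, the number of parameters $p$ and the dimension $a$ of the ambient space. $$(3;2,2,3)\to(17,18,19),\quad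 (3;3,4,5)\to(52,53,55),\quad (3;4,3,5)\to(52,53,55),\quad (3;4,6,7)\to(116,117,119),\quad (3;6,4,7)\to(116,117,119),\quad (3;5,8,9)\to(218,219,219),\quad (3;8,5,9)\to(218,219,219)$$ $$(4;2,2,3)\to(27,28,34),\quad (4;3,3,4)\to(63,68,69),\quad (4;3,4,5)\to(102,103,125),\quad (4;4,3,5)\to(102,103,125),\quad (4;4,4,5)\to(122,138,125),\quad (4;4,5,6)\to(189,194,209),\quad (4;5,4,6)\to(189,194,209),\quad (4;4,6,7)\to(277,278,329),\quad (4;5,6,7)\to(318,334,329),\quad (4;6,4,7)\to(277,278,329),\quad (4;6,5,7)\to(318,334,329),\quad (4;5,7,8)\to(449,454,494),\quad (4;6,6,8)\to(417,418,494),\quad (4;7,5,8)\to(449,454,494)$$ $$(5;2,2,3)\to(39,40,55),\quad (5;3,3,4)\to(104,110,125),\quad (5;3,4,5)\to(179,180,251),\quad (5;4,3,5)\to(179,180,251),\quad (5;4,4,5)\to(228,250,251),\quad (5;4,5,6)\to(370,376,461),\quad (5;5,4,6)\to(370,376,461),\quad (5;5,5,6)\to(441,502,461),\quad (5;4,6,7)\to(585,586,791),\quad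 (5;5,6,7)\to(690,712,791),\quad (5;6,4,7)\to(585,586,791),\quad (5;6,5,7)\to(690,712,791),\quad (5;6,6,7)\to(780,922,791)$$ Thus there are $7$, $14$ and $13$ defective cases ($34$ in total) for $n=3,4,5$ respectively, and none for $n=1$ and $n=2$ in this range. -/

import Mathlib

namespace TaylorVariety

/-- The exponent vectors `γ ∈ ℕⁿ` with `|γ| ≤ m`, i.e. the monomials of degree at most `m` in `n`
variables. -/
abbrev Exponent (n m : ℕ) : Type := {γ : Fin n →₀ ℕ // γ.degree ≤ m}

/-- The projective space of polynomials of degree at most `m` in `n` variables, up to scaling,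
with homogeneous coordinates `c_γ`. -/
abbrev AmbientSpace (n m : ℕ) : Type := Projectivization ℂ (Exponent n m → ℂ)

section Projective

variable {σ : Type}

/-- Vanishing of a polynomial `F` at a point of projective space. It is only used for homogeneous
`F`, where it does not depend on the chosen representative vector. -/
def VanishesAt (F : MvPolynomial σ ℂ) (x : Projectivization ℂ (σ → ℂ)) : Prop :=
  MvPolynomial.eval x.rep F = 0

/-- The Zariski closure of a subset `S` of projective space: the set of all points at which every
homogeneous polynomial that vanishes on `S` vanishes. -/
def zariskiClosure (S : Set (Projectivization ℂ (σ → ℂ))) : Set (Projectivization ℂ (σ → ℂ)) :=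
  {x | ∀ (k : ℕ) (F : MvPolynomial σ ℂ), F.IsHomogeneous k → (∀ y ∈ S, VanishesAt F y) →
    VanishesAt F x}

/-- The homogeneous ideal of a subset of projective space, generated by all homogeneous
polynomials that vanish on it. -/
noncomputable def homogeneousIdeal (X : Set (Projectivization ℂ (σ → ℂ))) : Ideal (MvPolynomial σ ℂ) :=
  Ideal.span {F | (∃ k : ℕ, F.IsHomogeneous k) ∧ ∀ x ∈ X, VanishesAt F x}

/-- The homogeneous coordinate ring of a subset of projective space. -/
abbrev CoordinateRing (X : Set (Projectivization ℂ (σ → ℂ))) : Type :=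
  MvPolynomial σ ℂ ⧸ homogeneousIdeal X

/-- The dimension of a projective variety: the Krull dimension of its homogeneous coordinate ring
minus one. The value is `⊥` for the empty set; for a nonempty set the coordinate ring has
dimension at least one, so the subtraction does not truncate. -/
noncomputable def projectiveDim (X : Set (Projectivization ℂ (σ → ℂ))) : WithBot ℕ∞ :=
  (ringKrullDim (CoordinateRing X)).map (fun k : ℕ∞ => k - 1)

end Projective

/-- The coefficients `c_γ`, `|γ| ≤ m`, of the Taylor expansion at the origin of the rational
function `P / Q`, where `Q` has nonzero constant term. -/
noncomputable def taylorCoeffs {n : ℕ} (m : ℕ) (P Q : MvPolynomial (Fin n) ℂ) :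
    Exponent n m → ℂ :=
  fun γ => MvPowerSeries.coeff γ.1
    ((P : MvPowerSeries (Fin n) ℂ) * (Q : MvPowerSeries (Fin n) ℂ)⁻¹)

/-- The points of projective space given by the Taylor polynomials of order `m` of the rational
functions `P / Q` with `deg P ≤ d`, `deg Q ≤ e` and `P(0) = Q(0) = 1`. -/
def taylorPoints (n d e m : ℕ) : Set (AmbientSpace n m) :=
  {x | ∃ P Q : MvPolynomial (Fin n) ℂ, P.totalDegree ≤ d ∧ Q.totalDegree ≤ e ∧
    MvPolynomial.constantCoeff P = 1 ∧ MvPolynomial.constantCoeff Q = 1 ∧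
    ∃ h : taylorCoeffs m P Q ≠ 0, x = Projectivization.mk ℂ (taylorCoeffs m P Q) h}

/-- The Taylor variety. -/
def taylorVariety (n d e m : ℕ) : Set (AmbientSpace n m) :=
  zariskiClosure (taylorPoints n d e m)

/-- The number of free coefficients of a pair `(P, Q)` with `P(0) = Q(0) = 1`. -/
def numParameters (n d e : ℕ) : ℕ := (d + n).choose n + (e + n).choose n - 2

/-- The dimension of the ambient projective space. -/
def ambientDim (n m : ℕ) : ℕ := (m + n).choose n - 1

/-- The expected dimension of the Taylor variety. -/
def expectedDim (n d e m : ℕ) : ℕ := min (numParameters n d e) (ambientDim n m)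

/-- A Taylor variety is defective if its dimension is strictly smaller than expected. -/
def IsDefective (n d e m : ℕ) : Prop :=
  projectiveDim (taylorVariety n d e m) < ((expectedDim n d e m : ℕ) : WithBot ℕ∞)

/-- A row of the table: the number of variables, the degrees of numerator and denominator, the
order of the Taylor polynomials, and then the dimension of the Taylor variety, the number of
parameters and the dimension of the ambient projective space. -/
structure Row where
  n : ℕ
  d : ℕ
  e : ℕ
  m : ℕ
  dim : ℕ
  params : ℕ
  ambient : ℕ

/-- The table of defective Taylor varieties, with rows `⟨n, d, e, m, dim, params, ambient⟩`. -/
def table : List Row :=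
  [⟨3, 2, 2, 3, 17, 18, 19⟩,
   ⟨3, 3, 4, 5, 52, 53, 55⟩,
   ⟨3, 4, 3, 5, 52, 53, 55⟩,
   ⟨3, 4, 6, 7, 116, 117, 119⟩,
   ⟨3, 6, 4, 7, 116, 117, 119⟩,
   ⟨3, 5, 8, 9, 218, 219, 219⟩,
   ⟨3, 8, 5, 9, 218, 219, 219⟩,
   ⟨4, 2, 2, 3, 27, 28, 34⟩,
   ⟨4, 3, 3, 4, 63, 68, 69⟩,
   ⟨4, 3, 4, 5, 102, 103, 125⟩,
   ⟨4, 4, 3, 5, 102, 103, 125⟩,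
   ⟨4, 4, 4, 5, 122, 138, 125⟩,
   ⟨4, 4, 5, 6, 189, 194, 209⟩,
   ⟨4, 5, 4, 6, 189, 194, 209⟩,
   ⟨4, 4, 6, 7, 277, 278, 329⟩,
   ⟨4, 5, 6, 7, 318, 334, 329⟩,
   ⟨4, 6, 4, 7, 277, 278, 329⟩,
   ⟨4, 6, 5, 7, 318, 334, 329⟩,
   ⟨4, 5, 7, 8, 449, 454, 494⟩,
   ⟨4, 6, 6, 8, 417, 418, 494⟩,
   ⟨4, 7, 5, 8, 449, 454, 494⟩,
   ⟨5, 2, 2, 3, 39, 40, 55⟩,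
   ⟨5, 3, 3, 4, 104, 110, 125⟩,
   ⟨5, 3, 4, 5, 179, 180, 251⟩,
   ⟨5, 4, 3, 5, 179, 180, 251⟩,
   ⟨5, 4, 4, 5, 228, 250, 251⟩,
   ⟨5, 4, 5, 6, 370, 376, 461⟩,
   ⟨5, 5, 4, 6, 370, 376, 461⟩,
   ⟨5, 5, 5, 6, 441, 502, 461⟩,
   ⟨5, 4, 6, 7, 585, 586, 791⟩,
   ⟨5, 5, 6, 7, 690, 712, 791⟩,
   ⟨5, 6, 4, 7, 585, 586, 791⟩,
   ⟨5, 6, 5, 7, 690, 712, 791⟩,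
   ⟨5, 6, 6, 7, 780, 922, 791⟩]

end TaylorVariety

/-! Let P and Q be generic polynomials of degrees d and e with constant term 1, let c = P/Q be the
generic quotient, and let s be one more variable for scaling. The homogeneous coordinate ring of the
Taylor variety is the algebra generated by the elements s·c_γ with |γ| ≤ m inside a polynomial ring
(`coordinateRingEquiv`). It is a finitely generated domain, so Noether normalization identifies its
Krull dimension with its transcendence degree (`ringKrullDim_eq_of_trdeg_eq`), and the projective
dimension is one less.

This degree is governed by the linear map that sends a polynomial U with terms in degrees 1,…,e to
the part of U·c in degrees d+1,…,m. From below: the coefficients of Q solve the linear system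
expressing that Q·c has no terms in these degrees, with coefficients in the field generated by the
c_γ. Rank r makes r of them redundant, while P is recovered from Q and c; hence the dimension is at
least the number of coefficients of P plus r (`le_trdeg_coneAlgebra`). Rank can only drop under
specialization, so it suffices to compute it over the field with two elements at Q = 1 and a
pseudorandom P, where c is P itself (`le_trdeg_of_finrank`). This is a finite computation with
binary vectors (`lowerCheckAll_eq_true`).

From above: an element U of the kernel gives a derivation moving Q by U and P by U·c, which kills
every generator. Independent kernel elements therefore bound the transcendence degree of the
parameter ring over the coordinate ring from below (`trdeg_coneAlgebra_add_le`). The defects come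
from explicit kernel elements. When m = d+1 these are Koszul syzygies of the homogeneous components
of c (`trdeg_add_koszulRank_le`); for (4;6,6,8) it is a combination of 2 × 2 minors of these
components (`coeff_minorSeries_mul`).

Replacing c by its inverse exchanges d and e (`trdeg_coneAlgebra_swap`), and for m ≤ d the variety
fills its ambient space, which leaves finitely many cases e ≤ d < m. Upper bounds are needed only
for rows of the table, since elsewhere the lower bound already equals the expected dimension. -/

/-! ### Krull dimension and transcendence degree -/

open Order in
/-- Going up: an integral injective extension preserves the Krull dimension. -/
theorem ringKrullDim_eq_of_isIntegral_of_injective {R S : Type*} [CommRing R] [CommRing S]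
    [Algebra R S] [Algebra.IsIntegral R S] (hinj : Function.Injective (algebraMap R S)) :
    ringKrullDim S = ringKrullDim R := by
  apply le_antisymm
  · refine krullDim_le_of_strictMono (PrimeSpectrum.comap (algebraMap R S)) ?_
    intro p q hpq
    exact Ideal.IsIntegral.comap_lt_comap (R := R) hpq
  -- Chains are lifted from the bottom up; remembering the prime below the last element is what
  -- allows going up to extend the lifted chain.
  · have key : ∀ l : LTSeries (PrimeSpectrum R), ∃ l' : LTSeries (PrimeSpectrum S),
        l'.length = l.length ∧ PrimeSpectrum.comap (algebraMap R S) l'.last = l.last := by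
      intro l
      induction l using RelSeries.inductionOn' with
      | singleton p =>
        obtain ⟨Q, -, hQ, h⟩ := Ideal.exists_ideal_over_prime_of_isIntegral (S := S) p.asIdeal ⊥ (by
          rw [Ideal.comap_bot_of_injective _ hinj]; exact bot_le)
        exact ⟨RelSeries.singleton _ ⟨Q, hQ⟩, rfl, PrimeSpectrum.ext h⟩
      | snoc l p hp ih =>
        obtain ⟨l', hl, hlast⟩ := ih
        obtain ⟨Q, hle, hQ, h⟩ := Ideal.exists_ideal_over_prime_of_isIntegral (S := S) p.asIdeal
          l'.last.asIdeal (by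
            have : l.last < p := hp
            have h2 := congrArg PrimeSpectrum.asIdeal hlast
            rw [PrimeSpectrum.comap_asIdeal] at h2
            rw [h2]; exact this.le)
        have hlt : l'.last < ⟨Q, hQ⟩ := by
          refine lt_of_le_of_ne hle ?_
          rintro heq
          have : l.last < p := hp
          rw [← hlast, heq] at this
          exact this.ne (PrimeSpectrum.ext h)
        exact ⟨l'.snoc ⟨Q, hQ⟩ hlt, by simp [hl], by simpa using PrimeSpectrum.ext h⟩
    refine iSup_le fun l => ?_
    obtain ⟨l', hl, -⟩ := key l
    rw [← hl]
    exact LTSeries.length_le_krullDim l'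

/-- The Krull dimension of a finitely generated domain over a field is its transcendence degree. -/
theorem ringKrullDim_eq_of_trdeg_eq {k A : Type*} [Field k] [CommRing A] [IsDomain A] [Algebra k A]
    [Algebra.FiniteType k A] {r : ℕ} (h : Algebra.trdeg k A = r) : ringKrullDim A = r := by
  obtain ⟨s, g, hg, hint⟩ := exists_integral_inj_algHom_of_fg k A
  let : Algebra (MvPolynomial (Fin s) k) A := g.toRingHom.toAlgebra
  have : IsScalarTower k (MvPolynomial (Fin s) k) A := IsScalarTower.of_algebraMap_eq' g.comp_algebraMap.symm
  have : Algebra.IsIntegral (MvPolynomial (Fin s) k) A := ⟨hint⟩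
  rw [ringKrullDim_eq_of_isIntegral_of_injective (R := MvPolynomial (Fin s) k) hg]
  rw [MvPolynomial.ringKrullDim_of_isNoetherianRing, ringKrullDim_eq_zero_of_field]
  have : FaithfulSMul (MvPolynomial (Fin s) k) A := (faithfulSMul_iff_algebraMap_injective _ _).2 hg
  have h1 := lift_trdeg_add_eq k (MvPolynomial (Fin s) k) A
  rw [MvPolynomial.trdeg_of_isDomain, h, trdeg_eq_zero] at h1
  have : s = r := by simpa using h1
  simp [this]

/-! ### Counting monomials -/

namespace TaylorVariety

open Finset in
theorem card_exponent_eq_multichoose (n m : ℕ) :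
    Nat.card (Exponent n m) = Nat.multichoose (n + 1) m := by
  have hfin : ∀ k, {γ : Fin n →₀ ℕ | γ.degree ≤ k}.Finite := fun k => Finsupp.finite_of_degree_le k
  have hdeg : ∀ k, {γ : Fin n →₀ ℕ | γ.degree = k}
      = ((Finset.univ : Finset (Fin n)).finsuppAntidiag k : Set (Fin n →₀ ℕ)) := by
    intro k
    ext γ
    simp [Finset.mem_finsuppAntidiag, Finsupp.degree_eq_sum]
  have hcard : ∀ k, {γ : Fin n →₀ ℕ | γ.degree = k}.ncard = Nat.multichoose n k := by
    intro k
    rw [hdeg, Set.ncard_coe_finset, card_finsuppAntidiag_nat_eq_multichoose]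
    simp
  change Nat.card {γ : Fin n →₀ ℕ | γ.degree ≤ m} = _
  rw [Nat.card_coe_set_eq]
  induction m with
  | zero =>
    have : {γ : Fin n →₀ ℕ | γ.degree ≤ 0} = {γ : Fin n →₀ ℕ | γ.degree = 0} := by
      ext; simp
    rw [this, hcard]; simp
  | succ m ih =>
    have h1 : {γ : Fin n →₀ ℕ | γ.degree ≤ m + 1}
        = {γ : Fin n →₀ ℕ | γ.degree = m + 1} ∪ {γ : Fin n →₀ ℕ | γ.degree ≤ m} := by
      ext γ; simp only [Set.mem_ofPred_eq, Set.mem_union]; omega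
    rw [h1, Set.ncard_union_eq ?_ (Finsupp.finite_of_degree_eq _) (hfin m), ih, hcard,
      Nat.multichoose_succ_succ]
    rw [Set.disjoint_left]
    intro γ h h'
    simp only [Set.mem_ofPred_eq] at h h'
    omega

/-- The number of monomials of degree at most `m` in `n` variables. -/
theorem card_exponent (n m : ℕ) : Nat.card (Exponent n m) = (m + n).choose n := by
  rw [card_exponent_eq_multichoose, Nat.multichoose_eq]
  rw [show n + 1 + m - 1 = m + n by omega, Nat.choose_symm_add]

/-- The exponents of the free coefficients of a polynomial of degree at most `d` with constant
coefficient `1`. -/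
abbrev CoeffIdx (n d : ℕ) : Type := {γ : Fin n →₀ ℕ // γ ≠ 0 ∧ γ.degree ≤ d}

instance finite_exponent (n m : ℕ) : Finite (Exponent n m) := (Finsupp.finite_of_degree_le m).to_subtype

instance finite_coeffIdx (n d : ℕ) : Finite (CoeffIdx n d) :=
  ((Finsupp.finite_of_degree_le d).subset fun _ h => h.2 :
    {γ : Fin n →₀ ℕ | γ ≠ 0 ∧ γ.degree ≤ d}.Finite).to_subtype

theorem card_coeffIdx_add_one (n d : ℕ) : Nat.card (CoeffIdx n d) + 1 = (d + n).choose n := by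
  rw [← card_exponent]
  change Nat.card {γ : Fin n →₀ ℕ | γ ≠ 0 ∧ γ.degree ≤ d} + 1 = Nat.card {γ : Fin n →₀ ℕ | γ.degree ≤ d}
  rw [Nat.card_coe_set_eq, Nat.card_coe_set_eq,
    show {γ : Fin n →₀ ℕ | γ ≠ 0 ∧ γ.degree ≤ d} = {γ : Fin n →₀ ℕ | γ.degree ≤ d} \ {0} by
      ext; simp [and_comm]]
  exact Set.ncard_sdiff_singleton_add_one (by simp) (Finsupp.finite_of_degree_le d)

end TaylorVariety

/-! ### The generic quotient and the coordinate ring of the cone -/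

namespace TaylorVariety

/-- The power series of the polynomial with constant coefficient `1` and the other coefficients of
degree at most `d` given by `p`. -/
noncomputable def unitSeries {R : Type} [CommRing R] {n d : ℕ} (p : CoeffIdx n d → R) :
    MvPowerSeries (Fin n) R :=
  fun γ => if h : γ ≠ 0 ∧ γ.degree ≤ d then p ⟨γ, h⟩ else if γ = 0 then 1 else 0

/-- The power series of the quotient of two polynomials with constant coefficient `1`. -/
noncomputable def quotSeries {R : Type} [CommRing R] {n d e : ℕ} (p : CoeffIdx n d → R)
    (q : CoeffIdx n e → R) : MvPowerSeries (Fin n) R :=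
  unitSeries p * MvPowerSeries.invOfUnit (unitSeries q) 1

section Series

variable {R S : Type} [CommRing R] [CommRing S] {n d e : ℕ}

theorem coeff_unitSeries (p : CoeffIdx n d → R) (γ : Fin n →₀ ℕ) :
    MvPowerSeries.coeff γ (unitSeries p)
      = if h : γ ≠ 0 ∧ γ.degree ≤ d then p ⟨γ, h⟩ else if γ = 0 then 1 else 0 := rfl

theorem coeff_unitSeries_coeffIdx (p : CoeffIdx n d → R) (γ : CoeffIdx n d) :
    MvPowerSeries.coeff γ.1 (unitSeries p) = p γ := by
  rw [coeff_unitSeries, dif_pos γ.2]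

theorem coeff_unitSeries_of_lt (p : CoeffIdx n d → R) {γ : Fin n →₀ ℕ} (h : d < γ.degree) :
    MvPowerSeries.coeff γ (unitSeries p) = 0 := by
  rw [coeff_unitSeries, dif_neg (by omega), if_neg]
  rintro rfl
  simp at h

@[simp]
theorem constantCoeff_unitSeries (p : CoeffIdx n d → R) :
    MvPowerSeries.constantCoeff (unitSeries p) = 1 := by
  rw [← MvPowerSeries.coeff_zero_eq_constantCoeff_apply, coeff_unitSeries]
  simp

theorem map_unitSeries (f : R →+* S) (p : CoeffIdx n d → R) :
    MvPowerSeries.map f (unitSeries p) = unitSeries (fun i => f (p i)) := by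
  ext γ
  rw [MvPowerSeries.coeff_map, coeff_unitSeries, coeff_unitSeries]
  split_ifs <;> simp

theorem unitSeries_mul_quotSeries (p : CoeffIdx n d → R) (q : CoeffIdx n e → R) :
    unitSeries q * quotSeries p q = unitSeries p := by
  rw [quotSeries, mul_left_comm, MvPowerSeries.mul_invOfUnit _ _ (by simp), mul_one]

theorem unitSeries_mul_left_cancel (q : CoeffIdx n e → R) {f g : MvPowerSeries (Fin n) R}
    (h : unitSeries q * f = unitSeries q * g) : f = g := by
  have := congrArg (MvPowerSeries.invOfUnit (unitSeries q) 1 * ·) h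
  simpa [← mul_assoc, MvPowerSeries.invOfUnit_mul] using this

/-- Both sides solve `Q * f = P` over the target ring, and the solution is unique because `Q` is a
unit. This permits evaluating, specializing and renaming the generic series. -/
theorem map_quotSeries (f : R →+* S) (p : CoeffIdx n d → R) (q : CoeffIdx n e → R) :
    MvPowerSeries.map f (quotSeries p q) = quotSeries (fun i => f (p i)) (fun i => f (q i)) := by
  apply unitSeries_mul_left_cancel (fun i => f (q i))
  rw [unitSeries_mul_quotSeries, ← map_unitSeries, ← map_mul, unitSeries_mul_quotSeries,
    map_unitSeries]

@[simp]
theorem constantCoeff_quotSeries (p : CoeffIdx n d → R) (q : CoeffIdx n e → R) :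
    MvPowerSeries.constantCoeff (quotSeries p q) = 1 := by
  simp [quotSeries]

end Series

/-- The index type of the parameters: the free coefficients of numerator and denominator. -/
abbrev Params (n d e : ℕ) : Type := CoeffIdx n d ⊕ CoeffIdx n e

/-- The coordinate ring of the cone over the parameter space; the variable `none` is the scaling
factor. -/
abbrev ConeRing (n d e : ℕ) : Type := MvPolynomial (Option (Params n d e)) ℂ

/-- The quotient of the generic polynomials with constant coefficient `1`. -/
noncomputable def genericSeries (n d e : ℕ) : MvPowerSeries (Fin n) (ConeRing n d e) :=
  quotSeries (fun i : CoeffIdx n d => MvPolynomial.X (some (Sum.inl i)))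
    (fun i : CoeffIdx n e => MvPolynomial.X (some (Sum.inr i)))

/-- The coordinates of the generic point of the cone over the Taylor variety. -/
noncomputable def coneCoord (n d e m : ℕ) (γ : Exponent n m) : ConeRing n d e :=
  MvPolynomial.X none * MvPowerSeries.coeff γ.1 (genericSeries n d e)

/-- The algebra generated by the coordinates of the generic point of the cone. -/
noncomputable def coneAlgebra (n d e m : ℕ) : Subalgebra ℂ (ConeRing n d e) :=
  Algebra.adjoin ℂ (Set.range (coneCoord n d e m))

theorem eval_coneCoord {n d e m : ℕ} (v : Option (Params n d e) → ℂ) (γ : Exponent n m) :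
    MvPolynomial.eval v (coneCoord n d e m γ) = v none * MvPowerSeries.coeff γ.1
      (quotSeries (fun i : CoeffIdx n d => v (some (Sum.inl i)))
        (fun i : CoeffIdx n e => v (some (Sum.inr i)))) := by
  rw [coneCoord, map_mul, MvPolynomial.eval_X]
  congr 1
  rw [← MvPowerSeries.coeff_map, genericSeries, map_quotSeries]
  simp

theorem coe_eq_unitSeries {n d : ℕ} (P : MvPolynomial (Fin n) ℂ) (hP : P.totalDegree ≤ d)
    (h1 : MvPolynomial.constantCoeff P = 1) :
    (P : MvPowerSeries (Fin n) ℂ) = unitSeries (fun γ : CoeffIdx n d => P.coeff γ.1) := by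
  ext γ
  rw [MvPolynomial.coeff_coe, coeff_unitSeries]
  split_ifs with h h'
  · rfl
  · subst h'; exact h1
  · refine MvPolynomial.coeff_eq_zero_of_totalDegree_lt ?_
    have : d < γ.degree := by by_contra hc; exact h ⟨h', by omega⟩
    rw [Finsupp.degree] at this
    exact lt_of_le_of_lt hP this

theorem taylorCoeffs_eq {n d e m : ℕ} {P Q : MvPolynomial (Fin n) ℂ} (hP : P.totalDegree ≤ d)
    (hQ : Q.totalDegree ≤ e) (hP1 : MvPolynomial.constantCoeff P = 1)
    (hQ1 : MvPolynomial.constantCoeff Q = 1) (γ : Exponent n m) :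
    taylorCoeffs m P Q γ = MvPowerSeries.coeff γ.1
      (quotSeries (fun γ : CoeffIdx n d => P.coeff γ.1) (fun γ : CoeffIdx n e => Q.coeff γ.1)) := by
  rw [taylorCoeffs, quotSeries, ← coe_eq_unitSeries P hP hP1, ← coe_eq_unitSeries Q hQ hQ1,
    MvPowerSeries.invOfUnit_eq']
  rw [coe_eq_unitSeries Q hQ hQ1]
  simp

open Classical in
/-- The polynomial with constant coefficient `1` and given other coefficients. -/
theorem exists_polynomial_coeff {n d : ℕ} (p : CoeffIdx n d → ℂ) :
    ∃ P : MvPolynomial (Fin n) ℂ, P.totalDegree ≤ d ∧ MvPolynomial.constantCoeff P = 1 ∧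
      (fun γ : CoeffIdx n d => P.coeff γ.1) = p := by
  have : Fintype (CoeffIdx n d) := Fintype.ofFinite _
  refine ⟨1 + ∑ γ : CoeffIdx n d, MvPolynomial.monomial γ.1 (p γ), ?_, ?_, ?_⟩
  · refine (MvPolynomial.totalDegree_add _ _).trans (max_le (by simp) ?_)
    refine MvPolynomial.totalDegree_finsetSum_le fun γ _ => ?_
    exact (MvPolynomial.totalDegree_monomial_le _ _).trans γ.2.2
  · rw [map_add, map_one, map_sum]
    rw [Finset.sum_eq_zero, add_zero]
    intro γ _
    rw [MvPolynomial.constantCoeff_monomial, if_neg γ.2.1]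
  · funext γ
    rw [MvPolynomial.coeff_add, MvPolynomial.coeff_sum, MvPolynomial.coeff_one,
      if_neg (Ne.symm γ.2.1), zero_add, Finset.sum_eq_single γ]
    · simp
    · intro b _ hb
      rw [MvPolynomial.coeff_monomial, if_neg (fun h => hb (Subtype.ext h))]
    · simp

theorem quotSeries_ne_zero {n d e m : ℕ} (p : CoeffIdx n d → ℂ) (q : CoeffIdx n e → ℂ) :
    (fun γ : Exponent n m => MvPowerSeries.coeff γ.1 (quotSeries p q)) ≠ 0 := by
  intro h
  have := congrFun h ⟨0, by simp⟩
  simp at this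

theorem eval_mul_of_isHomogeneous {σ : Type} {F : MvPolynomial σ ℂ} {k : ℕ} (hF : F.IsHomogeneous k)
    (s : ℂ) (x : σ → ℂ) :
    MvPolynomial.eval (fun i => s * x i) F = s ^ k * MvPolynomial.eval x F := by
  rw [MvPolynomial.eval_eq, MvPolynomial.eval_eq, Finset.mul_sum]
  refine Finset.sum_congr rfl fun γ hγ => ?_
  simp only [mul_pow, Finset.prod_mul_distrib, Finset.prod_pow_eq_pow_sum]
  rw [show ∑ i ∈ γ.support, γ i = k from hF.degree_eq_sum_deg_support hγ ▸ rfl]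
  ring

theorem vanishesAt_mk_iff {σ : Type} {F : MvPolynomial σ ℂ} {k : ℕ} (hF : F.IsHomogeneous k)
    (x : σ → ℂ) (hx : x ≠ 0) :
    VanishesAt F (Projectivization.mk ℂ x hx) ↔ MvPolynomial.eval x F = 0 := by
  obtain ⟨a, ha⟩ := Projectivization.exists_smul_eq_mk_rep ℂ x hx
  rw [VanishesAt, ← ha]
  have : MvPolynomial.eval (a • x) F = (a : ℂ) ^ k * MvPolynomial.eval x F :=
    eval_mul_of_isHomogeneous hF _ _
  rw [this]
  simp

theorem vanishesAt_taylorPoints_iff {n d e m k : ℕ} {F : MvPolynomial (Exponent n m) ℂ}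
    (hF : F.IsHomogeneous k) :
    (∀ x ∈ taylorPoints n d e m, VanishesAt F x) ↔ ∀ (p : CoeffIdx n d → ℂ) (q : CoeffIdx n e → ℂ),
      MvPolynomial.eval (fun γ : Exponent n m => MvPowerSeries.coeff γ.1 (quotSeries p q)) F = 0 := by
  constructor
  · intro h p q
    obtain ⟨P, hP, hP1, rfl⟩ := exists_polynomial_coeff p
    obtain ⟨Q, hQ, hQ1, rfl⟩ := exists_polynomial_coeff q
    have heq : taylorCoeffs m P Q = _ := funext fun γ => taylorCoeffs_eq hP hQ hP1 hQ1 γ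
    rw [← heq, ← vanishesAt_mk_iff hF _ (heq ▸ quotSeries_ne_zero _ _)]
    exact h _ ⟨P, Q, hP, hQ, hP1, hQ1, _, rfl⟩
  · rintro h x ⟨P, Q, hP, hQ, hP1, hQ1, h0, rfl⟩
    rw [vanishesAt_mk_iff hF, funext fun γ => taylorCoeffs_eq hP hQ hP1 hQ1 γ]
    exact h _ _

theorem vanishesAt_zariskiClosure_iff {σ : Type} {S : Set (Projectivization ℂ (σ → ℂ))} {k : ℕ}
    {F : MvPolynomial σ ℂ} (hF : F.IsHomogeneous k) :
    (∀ x ∈ zariskiClosure S, VanishesAt F x) ↔ ∀ x ∈ S, VanishesAt F x :=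
  ⟨fun h x hx => h x fun _ _ _ h' => h' x hx, fun h _ hx => hx k F hF h⟩

open Polynomial in
/-- If a polynomial vanishes on a line through the origin, then so do its homogeneous components. -/
theorem eval_homogeneousComponent_eq_zero {σ : Type} {F : MvPolynomial σ ℂ} {x : σ → ℂ}
    (h : ∀ s : ℂ, MvPolynomial.eval (fun i => s * x i) F = 0) (k : ℕ) :
    MvPolynomial.eval x (MvPolynomial.homogeneousComponent k F) = 0 := by
  let f : ℂ[X] := ∑ k ∈ Finset.range (F.totalDegree + 1),
    C (MvPolynomial.eval x (MvPolynomial.homogeneousComponent k F)) * X ^ k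
  have hf : f = 0 := by
    refine Polynomial.funext fun s => ?_
    rw [Polynomial.eval_zero, ← h s]
    conv_rhs => rw [← MvPolynomial.sum_homogeneousComponent F]
    rw [map_sum, Polynomial.eval_finsetSum]
    refine Finset.sum_congr rfl fun k _ => ?_
    rw [eval_mul_of_isHomogeneous (MvPolynomial.homogeneousComponent_isHomogeneous k F)]
    simp only [eval_mul, eval_C, eval_pow, eval_X]
    ring
  by_cases hk : k < F.totalDegree + 1
  · have := congrArg (fun g => Polynomial.coeff g k) hf
    simpa [f, Polynomial.coeff_C_mul, Polynomial.coeff_X_pow, hk] using this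
  · rw [MvPolynomial.homogeneousComponent_eq_zero _ _ (by omega), map_zero]

theorem aeval_coneCoord_eq_zero_iff {n d e m : ℕ} (F : MvPolynomial (Exponent n m) ℂ) :
    MvPolynomial.aeval (coneCoord n d e m) F = 0 ↔
      ∀ (s : ℂ) (p : CoeffIdx n d → ℂ) (q : CoeffIdx n e → ℂ), MvPolynomial.eval
        (fun γ : Exponent n m => s * MvPowerSeries.coeff γ.1 (quotSeries p q)) F = 0 := by
  have h : ∀ v, MvPolynomial.eval v (MvPolynomial.aeval (coneCoord n d e m) F)
      = MvPolynomial.eval (fun γ => MvPolynomial.eval v (coneCoord n d e m γ)) F := by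
    intro v
    have : ((MvPolynomial.aeval v).comp (MvPolynomial.aeval (R := ℂ) (coneCoord n d e m))) F
        = MvPolynomial.aeval (fun γ => MvPolynomial.aeval v (coneCoord n d e m γ)) F := by
      rw [MvPolynomial.comp_aeval]
    simpa [MvPolynomial.aeval_eq_eval] using this
  constructor
  · intro h0 s p q
    have := h (fun o => o.elim s (Sum.elim p q))
    rw [h0, map_zero] at this
    simpa [eval_coneCoord] using this.symm
  · intro h0
    refine MvPolynomial.funext fun v => ?_
    rw [h, map_zero]
    simpa [eval_coneCoord] using h0 (v none) _ _

/-- The scaling variable makes the kernel homogeneous: a relation among the coordinates holds along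
whole lines through the origin, so each homogeneous component is again a relation. A homogeneous
polynomial vanishes on the closure exactly when it vanishes on the Taylor points, that is, at the
generic point. -/
theorem ker_aeval_coneCoord (n d e m : ℕ) :
    RingHom.ker (MvPolynomial.aeval (R := ℂ) (coneCoord n d e m))
      = homogeneousIdeal (taylorVariety n d e m) := by
  apply le_antisymm
  · intro F hF
    rw [RingHom.mem_ker, aeval_coneCoord_eq_zero_iff] at hF
    rw [← MvPolynomial.sum_homogeneousComponent F]
    refine Ideal.sum_mem _ fun k _ => Ideal.subset_span ?_
    have hk := MvPolynomial.homogeneousComponent_isHomogeneous k F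
    refine ⟨⟨k, hk⟩, ?_⟩
    rw [taylorVariety, vanishesAt_zariskiClosure_iff hk, vanishesAt_taylorPoints_iff hk]
    exact fun p q => eval_homogeneousComponent_eq_zero (fun s => hF s p q) k
  · refine Ideal.span_le.2 ?_
    rintro F ⟨⟨k, hk⟩, hF⟩
    rw [taylorVariety, vanishesAt_zariskiClosure_iff hk, vanishesAt_taylorPoints_iff hk] at hF
    rw [SetLike.mem_coe, RingHom.mem_ker, aeval_coneCoord_eq_zero_iff]
    intro s p q
    rw [eval_mul_of_isHomogeneous hk, hF, mul_zero]

/-- The homogeneous coordinate ring of the Taylor variety is generated by the coordinates of the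
generic point of its cone. -/
noncomputable def coordinateRingEquiv (n d e m : ℕ) :
    CoordinateRing (taylorVariety n d e m) ≃+* coneAlgebra n d e m :=
  (Ideal.quotEquivOfEq (ker_aeval_coneCoord n d e m).symm).trans
    ((RingHom.quotientKerEquivRange
      (MvPolynomial.aeval (R := ℂ) (coneCoord n d e m)).toRingHom).trans
      (Subalgebra.equivOfEq _ _ (Algebra.adjoin_range_eq_range_aeval ℂ _).symm).toRingEquiv)

instance finiteType_coneAlgebra (n d e m : ℕ) : Algebra.FiniteType ℂ (coneAlgebra n d e m) :=
  (Subalgebra.fg_iff_finiteType _).1 (Subalgebra.fg_def.2 ⟨_, Set.finite_range _, rfl⟩)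

/-- The dimension of the Taylor variety in terms of the transcendence degree of the algebra
generated by the coordinates of the generic point of its cone. -/
theorem projectiveDim_taylorVariety {n d e m r : ℕ}
    (h : Algebra.trdeg ℂ (coneAlgebra n d e m) = (r + 1 : ℕ)) :
    projectiveDim (taylorVariety n d e m) = (r : ℕ) := by
  rw [projectiveDim, ringKrullDim_eq_of_ringEquiv (coordinateRingEquiv n d e m),
    ringKrullDim_eq_of_trdeg_eq h]
  change WithBot.map _ (((r + 1 : ℕ) : ℕ∞) : WithBot ℕ∞) = ((r : ℕ∞) : WithBot ℕ∞)
  rw [WithBot.map_coe]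
  congr 1

end TaylorVariety

/-! ### Derivations and transcendence degree -/

section Derivations

open Polynomial

variable {A B L : Type} [CommRing A] [CommRing B] [IsDomain B] [CharZero B] [Algebra A B]
  [Field L] [Algebra B L] [FaithfulSMul B L] [Algebra A L]

/-- A derivation kills every element that is a root of a nonzero polynomial with constant
coefficients. -/
theorem Derivation.eq_zero_of_aeval_eq_zero (D : Derivation A B L) (b : B) (f : A[X])
    (hinj : Function.Injective (algebraMap A B)) (hf : f ≠ 0) (h : aeval b f = 0) : D b = 0 := by
  have : IsDomain A := hinj.isDomain
  have : CharZero A := (algebraMap A B).charZero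
  induction hN : f.natDegree using Nat.strong_induction_on generalizing f with
  | _ N ih =>
    have hpos : f.natDegree ≠ 0 := by
      intro h0
      rw [Polynomial.eq_C_of_natDegree_eq_zero h0, aeval_C] at h
      apply hf
      rw [Polynomial.eq_C_of_natDegree_eq_zero h0, hinj (h.trans (map_zero _).symm), C_0]
    have hD := D.map_aeval f b
    rw [h, map_zero, Algebra.smul_def] at hD
    -- Here f'(b)·D(b) = 0. If the first factor vanishes, b is a root of f', which has smaller
    -- degree and is nonzero in characteristic zero.
    rcases mul_eq_zero.1 hD.symm with h1 | h1
    · have h2 := FaithfulSMul.algebraMap_injective B L (h1.trans (map_zero _).symm)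
      refine ih _ ?_ (derivative f) ?_ h2 rfl
      · rw [← hN]; exact natDegree_derivative_lt hpos
      · intro h3
        exact hpos (derivative_eq_zero.1 h3)
    · exact h1

/-- A derivation regarded as a derivation over a subalgebra of its constants. -/
def Derivation.overConstants (D : Derivation A B L) (S : Subalgebra A B)
    (h : ∀ s ∈ S, D s = 0) : Derivation S B L where
  toFun := D
  map_add' := map_add D
  map_smul' := fun s b => by
    simp [Subalgebra.smul_def, h s s.2]
  map_one_eq_zero' := D.map_one_eq_zero
  leibniz' := D.leibniz

theorem Derivation.eq_zero_of_isAlgebraic (D : Derivation A B L) (S : Subalgebra A B)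
    (h : ∀ s ∈ S, D s = 0) [Algebra.IsAlgebraic S B] : D = 0 := by
  ext b
  obtain ⟨f, hf, hb⟩ := Algebra.IsAlgebraic.isAlgebraic (R := S) b
  exact (D.overConstants S h).eq_zero_of_aeval_eq_zero b f Subtype.val_injective hf hb

/-- Independent derivations bound the transcendence degree from below. -/
theorem le_trdeg_of_linearIndependent_derivation [FaithfulSMul A B] {r : ℕ}
    (D : Fin r → Derivation A B L) (hD : LinearIndependent L (fun t b => D t b)) :
    (r : Cardinal) ≤ Algebra.trdeg A B := by
  have hinj : Function.Injective (algebraMap A B) := FaithfulSMul.algebraMap_injective A B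
  have : IsDomain A := hinj.isDomain
  obtain ⟨s, hs⟩ := exists_isTranscendenceBasis A B
  have hs' : LinearIndependent L (fun (t : Fin r) (i : s) => D t i) := by
    rw [Fintype.linearIndependent_iff] at hD ⊢
    intro a ha
    refine hD a ?_
    have hsum : ∀ b, (∑ t, a t • D t) b = ∑ t, a t * D t b := by
      intro b
      change Derivation.coeFnAddMonoidHom (∑ t, a t • D t) b = _
      rw [map_sum, Finset.sum_apply]
      rfl
    -- A combination that vanishes on the transcendence basis kills the subalgebra generated by it;
    -- the whole ring is algebraic over that subalgebra, so the combination is zero.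
    have h0 : ∑ t, a t • D t = 0 := by
      have := hs.isAlgebraic
      refine Derivation.eq_zero_of_isAlgebraic _ (Algebra.adjoin A (Set.range ((↑) : s → B))) ?_
      intro b hb
      induction hb using Algebra.adjoin_induction with
      | mem x hx =>
        obtain ⟨i, rfl⟩ := hx
        have := congrFun ha i
        rw [hsum]
        simpa using this
      | algebraMap x => simp
      | add x y _ _ hx hy => rw [map_add, hx, hy, add_zero]
      | mul x y _ _ hx hy => rw [Derivation.leibniz, hx, hy, smul_zero, smul_zero, add_zero]
    funext b
    have := congrArg (fun D' : Derivation A B L => D' b) h0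
    simpa [hsum] using this
  rw [← hs.cardinalMk_eq_trdeg]
  by_cases hfin : Finite s
  · have := Fintype.ofFinite s
    have h1 := hs'.fintype_card_le_finrank
    simp only [Fintype.card_fin, Module.finrank_fintype_fun_eq_card] at h1
    rw [Cardinal.mk_fintype]
    exact_mod_cast h1
  · have : Infinite s := not_finite_iff_infinite.1 hfin
    exact (Cardinal.natCast_lt_aleph0).le.trans (Cardinal.aleph0_le_mk s)

end Derivations

/-! ### Redundant unknowns in a linear system -/

section LinearSystem

open IntermediateField

open scoped IntermediateField.algebraAdjoinAdjoin in
theorem trdeg_adjoin_eq {k L : Type} [Field k] [Field L] [Algebra k L] (s : Set L) :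
    Algebra.trdeg k (Algebra.adjoin k s) = Algebra.trdeg k (IntermediateField.adjoin k s) := by
  have := trdeg_add_eq k (Algebra.adjoin k s) (A := IntermediateField.adjoin k s)
  rw [← this, trdeg_eq_zero (R := Algebra.adjoin k s), add_zero]

open scoped IntermediateField.algebraAdjoinAdjoin in
theorem isAlgebraic_adjoin_of_adjoin_eq_top {k L : Type} [Field k] [Field L] [Algebra k L] {s : Set L}
    (h : IntermediateField.adjoin k s = ⊤) : Algebra.IsAlgebraic (Algebra.adjoin k s) L := by
  refine ⟨fun y => ?_⟩
  have hy : y ∈ IntermediateField.adjoin k s := h ▸ IntermediateField.mem_top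
  exact (Algebra.IsAlgebraic.isAlgebraic (R := Algebra.adjoin k s)
    (⟨y, hy⟩ : IntermediateField.adjoin k s)).algebraMap (A := L)

/-- If a field is generated by the solution of a linear system of rank at least `r` with
coefficients in the base field, then `r` of the unknowns are redundant. -/
theorem trdeg_add_le_of_linear_system {E L I J : Type} [Field E] [Field L] [Algebra E L] [Finite I]
    [Finite J] {r : ℕ} (x : J → L) (hx : IntermediateField.adjoin E (Set.range x) = ⊤)
    (f : J → I → E) (b : I → E)
    (hb : ∀ i, ∑ᶠ j, x j * algebraMap E L (f j i) = algebraMap E L (b i))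
    (a : Fin r → J) (ha : LinearIndependent L (fun t i => algebraMap E L (f (a t) i))) :
    Algebra.trdeg E L + r ≤ Nat.card J := by
  classical
  have := Fintype.ofFinite I
  have := Fintype.ofFinite J
  simp only [finsum_eq_sum_of_fintype] at hb
  have hli : LinearIndependent E (fun t => f (a t)) := by
    rw [Fintype.linearIndependent_iff] at ha ⊢
    intro c hc t
    have := ha (fun t => algebraMap E L (c t)) ?_ t
    · exact (algebraMap E L).injective (this.trans (map_zero _).symm)
    · funext i
      have := congrArg (algebraMap E L) (congrFun hc i)
      simpa [Algebra.smul_def] using this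
  have hainj : Function.Injective a := fun t t' h => hli.injective (congrArg f h)
  -- A left inverse of the chosen columns: applied to the system, it solves for the unknowns `x (a
  -- t)` in terms of the others.
  obtain ⟨g, hg⟩ : ∃ g : (I → E) →ₗ[E] (Fin r → E), ∀ t, g (f (a t)) = Pi.single t 1 := by
    obtain ⟨g, hg⟩ := (Fintype.linearCombination E (fun t => f (a t))).exists_leftInverse_of_injective
      (LinearMap.ker_eq_bot.2 hli.fintypeLinearCombination_injective)
    refine ⟨g, fun t => ?_⟩
    have := LinearMap.congr_fun hg (Pi.single t 1)
    rw [LinearMap.comp_apply, Fintype.linearCombination_apply_single, one_smul] at this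
    exact this
  have hgsum : ∀ v t, g v t = ∑ i, v i * g (Pi.single i 1) t := by
    intro v t
    conv_lhs => rw [pi_eq_sum_univ' v]
    rw [map_sum, Finset.sum_apply]
    refine Finset.sum_congr rfl fun i _ => ?_
    rw [map_smul]
    rfl
  have key : ∀ t, ∑ j, x j * algebraMap E L (g (f j) t) = algebraMap E L (g b t) := by
    intro t
    have hmap : ∀ v, algebraMap E L (g v t)
        = ∑ i, algebraMap E L (v i) * algebraMap E L (g (Pi.single i 1) t) := by
      intro v
      rw [hgsum, map_sum]
      simp only [map_mul]
    rw [hmap b, Finset.sum_congr rfl fun j _ => by rw [hmap (f j), Finset.mul_sum], Finset.sum_comm]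
    refine Finset.sum_congr rfl fun i _ => ?_
    rw [← hb, Finset.sum_mul]
    exact Finset.sum_congr rfl fun j _ => by ring
  set s : Set L := x '' (Set.range a)ᶜ with hs
  have htop : IntermediateField.adjoin E s = ⊤ := by
    rw [eq_top_iff, ← hx, IntermediateField.adjoin_le_iff]
    have hcompl : ∀ j, j ∉ Set.range a → x j ∈ IntermediateField.adjoin E s := fun j hj =>
      IntermediateField.subset_adjoin _ _ ⟨j, hj, rfl⟩
    rintro _ ⟨j, rfl⟩
    by_cases hj : j ∈ Set.range a
    · obtain ⟨t, rfl⟩ := hj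
      have h1 := key t
      rw [← Finset.sum_filter_add_sum_filter_not _ (fun j => j ∈ Set.range a)] at h1
      have h2 : ∑ j with j ∈ Set.range a, x j * algebraMap E L (g (f j) t) = x (a t) := by
        rw [Finset.sum_eq_single (a t)]
        · rw [hg]; simp
        · intro j hj hne
          obtain ⟨t', rfl⟩ := (Finset.mem_filter.1 hj).2
          rw [hg, Pi.single_apply, if_neg (fun h => hne (by rw [h]))]
          simp
        · simp
      rw [h2] at h1
      rw [eq_sub_of_add_eq h1]
      refine sub_mem (IntermediateField.algebraMap_mem _ _) (sum_mem fun j hj => ?_)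
      exact mul_mem (hcompl j (Finset.mem_filter.1 hj).2) (IntermediateField.algebraMap_mem _ _)
    · exact hcompl j hj
  have := isAlgebraic_adjoin_of_adjoin_eq_top htop
  have h1 : Algebra.trdeg E L ≤ Cardinal.mk s := Algebra.IsAlgebraic.trdeg_le_cardinalMk E s
  have h2 : Cardinal.mk s ≤ ((Fintype.card J - r : ℕ) : Cardinal) := by
    refine Cardinal.mk_image_le.trans ?_
    rw [Cardinal.mk_fintype, Fintype.card_compl_set, Set.card_range_of_injective hainj,
      Fintype.card_fin]
  have h3 : r ≤ Fintype.card J := by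
    simpa using Fintype.card_le_of_injective a hainj
  calc Algebra.trdeg E L + r ≤ ((Fintype.card J - r : ℕ) : Cardinal) + r := by
        gcongr
        exact h1.trans h2
    _ = Nat.card J := by
        rw [← Nat.cast_add, Nat.sub_add_cancel h3, Nat.card_eq_fintype_card]

end LinearSystem

theorem trdeg_subalgebra_add_eq {k B : Type} [Field k] [CommRing B] [IsDomain B] [Algebra k B]
    (S : Subalgebra k B) : Algebra.trdeg k S + Algebra.trdeg S B = Algebra.trdeg k B :=
  trdeg_add_eq k S (A := B)

/-! ### Upper bound: directions that leave the Taylor polynomial unchanged -/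

namespace TaylorVariety

section Directions

variable {R S : Type} [CommRing R] [CommRing S] {n e : ℕ}

/-- The power series of the polynomial without constant term with coefficients `u`. -/
noncomputable def dirSeries (u : CoeffIdx n e → R) : MvPowerSeries (Fin n) R :=
  fun γ => if h : γ ≠ 0 ∧ γ.degree ≤ e then u ⟨γ, h⟩ else 0

theorem coeff_dirSeries (u : CoeffIdx n e → R) (γ : Fin n →₀ ℕ) :
    MvPowerSeries.coeff γ (dirSeries u) = if h : γ ≠ 0 ∧ γ.degree ≤ e then u ⟨γ, h⟩ else 0 := rfl

theorem unitSeries_eq_one_add (u : CoeffIdx n e → R) : unitSeries u = 1 + dirSeries u := by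
  classical
  ext γ
  rw [map_add, coeff_unitSeries, coeff_dirSeries, MvPowerSeries.coeff_one]
  split_ifs with h h' h'
  · exact absurd h' h.1
  · simp
  · simp
  · simp

theorem dirSeries_eq_sum [Fintype (CoeffIdx n e)] (u : CoeffIdx n e → R) :
    dirSeries u = ∑ β, MvPowerSeries.monomial β.1 (u β) := by
  classical
  ext γ
  rw [map_sum, coeff_dirSeries]
  simp only [MvPowerSeries.coeff_monomial]
  split_ifs with h
  · rw [Finset.sum_eq_single ⟨γ, h⟩]
    · simp
    · intro b _ hb
      rw [if_neg fun h' => hb (Subtype.ext h'.symm)]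
    · simp
  · symm
    refine Finset.sum_eq_zero fun b _ => if_neg ?_
    rintro rfl
    exact h b.2

theorem map_dirSeries (f : R →+* S) (u : CoeffIdx n e → R) :
    MvPowerSeries.map f (dirSeries u) = dirSeries (fun i => f (u i)) := by
  ext γ
  rw [MvPowerSeries.coeff_map, coeff_dirSeries, coeff_dirSeries]
  split_ifs <;> simp

theorem coeff_mul_eq_zero_of_degree_le {f : MvPowerSeries (Fin n) R} {m : ℕ}
    (hf : ∀ γ : Fin n →₀ ℕ, γ.degree ≤ m → MvPowerSeries.coeff γ f = 0) (g : MvPowerSeries (Fin n) R)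
    {γ : Fin n →₀ ℕ} (hγ : γ.degree ≤ m) : MvPowerSeries.coeff γ (g * f) = 0 := by
  classical
  rw [MvPowerSeries.coeff_mul]
  refine Finset.sum_eq_zero fun p hp => ?_
  rw [hf p.2, mul_zero]
  have := congrArg Finsupp.degree (Finset.HasAntidiagonal.mem_antidiagonal.1 hp)
  rw [map_add] at this
  omega

/-- A derivation applied to the coefficients of a power series. -/
noncomputable def derivSeries {k : Type} [CommRing k] [Algebra k R] (D : Derivation k R R)
    (f : MvPowerSeries (Fin n) R) : MvPowerSeries (Fin n) R :=
  fun γ => D (MvPowerSeries.coeff γ f)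

theorem coeff_derivSeries {k : Type} [CommRing k] [Algebra k R] (D : Derivation k R R)
    (f : MvPowerSeries (Fin n) R) (γ : Fin n →₀ ℕ) :
    MvPowerSeries.coeff γ (derivSeries D f) = D (MvPowerSeries.coeff γ f) := rfl

theorem derivSeries_mul {k : Type} [CommRing k] [Algebra k R] (D : Derivation k R R)
    (f g : MvPowerSeries (Fin n) R) :
    derivSeries D (f * g) = derivSeries D f * g + f * derivSeries D g := by
  classical
  ext γ
  rw [map_add, coeff_derivSeries]
  simp only [MvPowerSeries.coeff_mul, map_sum, ← Finset.sum_add_distrib]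
  refine Finset.sum_congr rfl fun p _ => ?_
  rw [D.leibniz, coeff_derivSeries, coeff_derivSeries, smul_eq_mul, smul_eq_mul]
  ring

end Directions

/-- The exponents of degree greater than `d` and at most `m`. -/
abbrev Window (n d m : ℕ) : Type := {γ : Fin n →₀ ℕ // d < γ.degree ∧ γ.degree ≤ m}

instance finite_window (n d m : ℕ) : Finite (Window n d m) :=
  ((Finsupp.finite_of_degree_le m).subset fun _ h => h.2 :
    {γ : Fin n →₀ ℕ | d < γ.degree ∧ γ.degree ≤ m}.Finite).to_subtype

/-- The function field of the cone over the parameter space. -/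
abbrev ConeField (n d e : ℕ) : Type := FractionRing (ConeRing n d e)

theorem trdeg_coneRing (n d e : ℕ) :
    Algebra.trdeg ℂ (ConeRing n d e) = (Nat.card (CoeffIdx n d) + Nat.card (CoeffIdx n e) + 1 : ℕ) := by
  have := Fintype.ofFinite (CoeffIdx n d)
  have := Fintype.ofFinite (CoeffIdx n e)
  rw [MvPolynomial.trdeg_of_isDomain, Cardinal.mk_fintype]
  simp [Nat.card_eq_fintype_card]

section Upper

variable {n d e m : ℕ}

/-- The derivation of the cone ring that moves the denominator in the direction `u`, and the
numerator such that the quotient is unchanged to first order up to degree `d`. -/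
noncomputable def kernelDerivation (u : CoeffIdx n e → ConeRing n d e) :
    Derivation ℂ (ConeRing n d e) (ConeRing n d e) :=
  MvPolynomial.mkDerivation ℂ (fun o => o.elim 0 (Sum.elim
    (fun γ => MvPowerSeries.coeff γ.1 (dirSeries u * genericSeries n d e)) u))

/-- Differentiating Q·c = P gives Q·Dc = DP − U·c. The right side vanishes up to degree d by the
choice of DP, and in degrees d+1,…,m by `hu`. Since Q is a unit, Dc vanishes up to degree m as well.
-/
theorem kernelDerivation_genericSeries (u : CoeffIdx n e → ConeRing n d e)
    (hu : ∀ γ : Fin n →₀ ℕ, d < γ.degree → γ.degree ≤ m →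
      MvPowerSeries.coeff γ (dirSeries u * genericSeries n d e) = 0)
    (γ : Fin n →₀ ℕ) (hγ : γ.degree ≤ m) :
    kernelDerivation u (MvPowerSeries.coeff γ (genericSeries n d e)) = 0 := by
  set P : MvPowerSeries (Fin n) (ConeRing n d e) :=
    unitSeries (fun i : CoeffIdx n d => MvPolynomial.X (some (Sum.inl i))) with hP
  set Q : MvPowerSeries (Fin n) (ConeRing n d e) :=
    unitSeries (fun i : CoeffIdx n e => MvPolynomial.X (some (Sum.inr i))) with hQ
  have hQc : Q * genericSeries n d e = P := unitSeries_mul_quotSeries _ _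
  have hDQ : derivSeries (kernelDerivation u) Q = dirSeries u := by
    ext1 γ
    rw [coeff_derivSeries, hQ, coeff_unitSeries, coeff_dirSeries]
    split_ifs
    · rw [kernelDerivation, MvPolynomial.mkDerivation_X]; rfl
    · rw [Derivation.map_one_eq_zero]
    · rw [map_zero]
  have hDP : ∀ γ : Fin n →₀ ℕ, γ.degree ≤ m → MvPowerSeries.coeff γ
      (derivSeries (kernelDerivation u) P - dirSeries u * genericSeries n d e) = 0 := by
    intro γ hγ
    rw [map_sub, coeff_derivSeries, hP, coeff_unitSeries]
    split_ifs with h h'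
    · rw [kernelDerivation, MvPolynomial.mkDerivation_X]
      exact sub_self _
    · subst h'
      rw [Derivation.map_one_eq_zero, zero_sub, neg_eq_zero,
        MvPowerSeries.coeff_zero_eq_constantCoeff_apply, map_mul,
        ← MvPowerSeries.coeff_zero_eq_constantCoeff_apply, coeff_dirSeries, dif_neg (by simp),
        zero_mul]
    · rw [map_zero, hu γ (by by_contra hc; exact h ⟨h', by omega⟩) hγ, sub_zero]
  have h1 := derivSeries_mul (kernelDerivation u) Q (genericSeries n d e)
  rw [hQc, hDQ] at h1
  have h2 : derivSeries (kernelDerivation u) (genericSeries n d e)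
      = MvPowerSeries.invOfUnit Q 1 *
        (derivSeries (kernelDerivation u) P - dirSeries u * genericSeries n d e) := by
    rw [h1, add_sub_cancel_left, ← mul_assoc, MvPowerSeries.invOfUnit_mul _ _ (by simp [hQ]), one_mul]
  rw [← coeff_derivSeries, h2]
  exact coeff_mul_eq_zero_of_degree_le hDP _ hγ

theorem kernelDerivation_coneAlgebra (u : CoeffIdx n e → ConeRing n d e)
    (hu : ∀ γ : Fin n →₀ ℕ, d < γ.degree → γ.degree ≤ m →
      MvPowerSeries.coeff γ (dirSeries u * genericSeries n d e) = 0)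
    {b : ConeRing n d e} (hb : b ∈ coneAlgebra n d e m) : kernelDerivation u b = 0 := by
  induction hb using Algebra.adjoin_induction with
  | mem x hx =>
    obtain ⟨γ, rfl⟩ := hx
    rw [coneCoord, Derivation.leibniz, kernelDerivation_genericSeries u hu γ.1 γ.2, kernelDerivation,
      MvPolynomial.mkDerivation_X]
    simp
  | algebraMap x => simp
  | add x y _ _ hx hy => rw [map_add, hx, hy, add_zero]
  | mul x y _ _ hx hy => rw [Derivation.leibniz, hx, hy, smul_zero, smul_zero, add_zero]

/-- Independent tangent directions along which the Taylor polynomial does not change bound the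
dimension of the Taylor variety from above. -/
theorem trdeg_coneAlgebra_add_le {r : ℕ} (u : Fin r → CoeffIdx n e → ConeRing n d e)
    (hli : LinearIndependent (ConeField n d e)
      (fun t β => algebraMap (ConeRing n d e) (ConeField n d e) (u t β)))
    (hu : ∀ t, ∀ γ : Fin n →₀ ℕ, d < γ.degree → γ.degree ≤ m →
      MvPowerSeries.coeff γ (dirSeries (u t) * genericSeries n d e) = 0) :
    Algebra.trdeg ℂ (coneAlgebra n d e m) + r
      ≤ (Nat.card (CoeffIdx n d) + Nat.card (CoeffIdx n e) + 1 : ℕ) := by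
  rw [← trdeg_coneRing, ← trdeg_subalgebra_add_eq (coneAlgebra n d e m)]
  gcongr
  have hconst : ∀ t, ∀ s ∈ coneAlgebra n d e m, ((Algebra.linearMap (ConeRing n d e)
      (ConeField n d e)).compDer (kernelDerivation (u t))) s = 0 := by
    intro t s hs
    change algebraMap _ _ (kernelDerivation (u t) s) = 0
    rw [kernelDerivation_coneAlgebra (u t) (hu t) hs, map_zero]
  refine le_trdeg_of_linearIndependent_derivation (L := ConeField n d e)
    (fun t => Derivation.overConstants _ (coneAlgebra n d e m) (hconst t)) ?_
  rw [Fintype.linearIndependent_iff] at hli ⊢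
  intro a ha
  refine hli a ?_
  funext β
  -- The derivation sends the denominator variable at `β` to `u t β`, so evaluating at these
  -- variables recovers the given independent vectors.
  have := congrFun ha (MvPolynomial.X (some (Sum.inr β)))
  simp only [Finset.sum_apply, Pi.smul_apply, Pi.zero_apply] at this ⊢
  rw [← this]
  refine Finset.sum_congr rfl fun t _ => ?_
  congr 1
  change _ = algebraMap _ _ (kernelDerivation (u t) _)
  rw [kernelDerivation, MvPolynomial.mkDerivation_X]
  rfl

end Upper

end TaylorVariety

theorem trdeg_intermediateField_add_eq {k L : Type} [Field k] [Field L] [Algebra k L]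
    (E : IntermediateField k L) : Algebra.trdeg k E + Algebra.trdeg E L = Algebra.trdeg k L :=
  trdeg_add_eq k E (A := L)

theorem trdeg_fractionRing_eq {k B L : Type} [Field k] [CommRing B] [IsDomain B] [Field L]
    [Algebra k B] [Algebra B L] [IsFractionRing B L] [Algebra k L] [IsScalarTower k B L] :
    Algebra.trdeg k L = Algebra.trdeg k B := by
  have h := trdeg_add_eq k B (A := L)
  have : Algebra.IsAlgebraic B L := IsLocalization.isAlgebraic _ (nonZeroDivisors B)
  rw [← h, trdeg_eq_zero (R := B), add_zero]

theorem trdeg_adjoin_eq_of_injective {k B L : Type} [Field k] [CommRing B] [Field L]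
    [Algebra k B] [Algebra k L] (f : B →ₐ[k] L) (hf : Function.Injective f) (s : Set B) :
    Algebra.trdeg k (Algebra.adjoin k s) = Algebra.trdeg k (IntermediateField.adjoin k (f '' s)) := by
  rw [← trdeg_adjoin_eq, ← f.map_adjoin]
  exact ((Algebra.adjoin k s).equivMapOfInjective f hf).trdeg_eq

/-! ### Lower bound: the linear system for the denominator -/

namespace TaylorVariety

section Lower

variable {n d e m : ℕ}

theorem coeff_monomial_one_mul {R : Type} [CommRing R] (β γ : Fin n →₀ ℕ)
    (f : MvPowerSeries (Fin n) R) [Decidable (β ≤ γ)] :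
    MvPowerSeries.coeff γ (MvPowerSeries.monomial β 1 * f)
      = if β ≤ γ then MvPowerSeries.coeff (γ - β) f else 0 := by
  classical
  rw [MvPowerSeries.coeff_monomial_mul]
  split_ifs <;> simp

theorem sum_mul_coeff_monomial_mul {R : Type} [CommRing R] [Fintype (CoeffIdx n e)]
    (u : CoeffIdx n e → R) (f : MvPowerSeries (Fin n) R) (γ : Fin n →₀ ℕ) :
    ∑ β, u β * MvPowerSeries.coeff γ (MvPowerSeries.monomial β.1 1 * f)
      = MvPowerSeries.coeff γ (dirSeries u * f) := by
  rw [dirSeries_eq_sum, Finset.sum_mul, map_sum]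
  refine Finset.sum_congr rfl fun β _ => ?_
  rw [← MvPowerSeries.coeff_C_mul, ← mul_assoc]
  congr 2
  classical
  ext δ
  rw [MvPowerSeries.coeff_C_mul, MvPowerSeries.coeff_monomial, MvPowerSeries.coeff_monomial]
  split_ifs <;> simp

variable (n d e m) in
/-- The field generated by the coordinates of the generic point of the cone over the Taylor
variety. -/
noncomputable def taylorField : IntermediateField ℂ (ConeField n d e) :=
  IntermediateField.adjoin ℂ (IsScalarTower.toAlgHom ℂ (ConeRing n d e) (ConeField n d e) ''
    Set.range (coneCoord n d e m))

theorem trdeg_coneAlgebra : Algebra.trdeg ℂ (coneAlgebra n d e m)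
    = Algebra.trdeg ℂ (taylorField n d e m) :=
  trdeg_adjoin_eq_of_injective _ (IsFractionRing.injective (ConeRing n d e) (ConeField n d e)) _

theorem coneCoord_mem_taylorField (γ : Exponent n m) :
    algebraMap (ConeRing n d e) (ConeField n d e) (coneCoord n d e m γ) ∈ taylorField n d e m :=
  IntermediateField.subset_adjoin _ _ ⟨_, ⟨γ, rfl⟩, rfl⟩

theorem scale_mem_taylorField :
    algebraMap (ConeRing n d e) (ConeField n d e) (MvPolynomial.X none) ∈ taylorField n d e m := by
  have := coneCoord_mem_taylorField (n := n) (d := d) (e := e) (m := m) ⟨0, by simp⟩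
  rwa [coneCoord, MvPowerSeries.coeff_zero_eq_constantCoeff_apply, genericSeries,
    constantCoeff_quotSeries, mul_one] at this

theorem coeff_genericSeries_mem_taylorField {γ : Fin n →₀ ℕ} (hγ : γ.degree ≤ m) :
    algebraMap (ConeRing n d e) (ConeField n d e) (MvPowerSeries.coeff γ (genericSeries n d e))
      ∈ taylorField n d e m := by
  have h := div_mem (coneCoord_mem_taylorField (n := n) (d := d) (e := e) (m := m) ⟨γ, hγ⟩)
    scale_mem_taylorField
  rwa [coneCoord, map_mul, mul_div_cancel_left₀] at h
  rw [Ne, FaithfulSMul.algebraMap_eq_zero_iff]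
  exact MvPolynomial.X_ne_zero _

theorem coeff_monomial_mul_mem_taylorField (β : Fin n →₀ ℕ) {γ : Fin n →₀ ℕ} (hγ : γ.degree ≤ m) :
    algebraMap (ConeRing n d e) (ConeField n d e)
      (MvPowerSeries.coeff γ (MvPowerSeries.monomial β 1 * genericSeries n d e))
      ∈ taylorField n d e m := by
  classical
  rw [coeff_monomial_one_mul]
  split_ifs with h
  · refine coeff_genericSeries_mem_taylorField (le_trans ?_ hγ)
    exact Finsupp.degree_mono tsub_le_self
  · rw [map_zero]; exact zero_mem _

/-- Comparing coefficients in Q·c = P expresses the numerator through the denominator and the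
coefficients of c of degree at most d ≤ m, all of which lie in the Taylor field. The scaling factor
lies there too, being the coordinate with exponent zero. -/
theorem adjoin_denominator_eq_top (hdm : d ≤ m) :
    IntermediateField.adjoin (taylorField n d e m) (Set.range fun β : CoeffIdx n e =>
      algebraMap (ConeRing n d e) (ConeField n d e) (MvPolynomial.X (some (Sum.inr β)))) = ⊤ := by
  have := Fintype.ofFinite (CoeffIdx n e)
  set K := IntermediateField.adjoin (taylorField n d e m) (Set.range fun β : CoeffIdx n e =>
      algebraMap (ConeRing n d e) (ConeField n d e) (MvPolynomial.X (some (Sum.inr β)))) with hK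
  have hE : ∀ y ∈ taylorField n d e m, y ∈ K := fun y hy =>
    IntermediateField.algebraMap_mem K (⟨y, hy⟩ : taylorField n d e m)
  have hq : ∀ β : CoeffIdx n e, algebraMap (ConeRing n d e) (ConeField n d e)
      (MvPolynomial.X (some (Sum.inr β))) ∈ K := fun β =>
    IntermediateField.subset_adjoin _ _ ⟨β, rfl⟩
  have hB : ∀ b : ConeRing n d e, algebraMap (ConeRing n d e) (ConeField n d e) b ∈ K := by
    intro b
    induction b using MvPolynomial.induction_on with
    | C a =>
      exact hE _ (IntermediateField.algebraMap_mem (taylorField n d e m) a)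
    | add p q hp hq => rw [map_add]; exact add_mem hp hq
    | mul_X p i hp =>
      rw [map_mul]
      refine mul_mem hp ?_
      match i with
      | none => exact hE _ scale_mem_taylorField
      | some (Sum.inr β) => exact hq β
      | some (Sum.inl γ) =>
        have h := congrArg (MvPowerSeries.coeff γ.1) (unitSeries_mul_quotSeries
          (fun i : CoeffIdx n d => (MvPolynomial.X (some (Sum.inl i)) : ConeRing n d e))
          (fun i : CoeffIdx n e => MvPolynomial.X (some (Sum.inr i))))
        rw [coeff_unitSeries_coeffIdx, unitSeries_eq_one_add, add_mul, one_mul, map_add,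
          ← sum_mul_coeff_monomial_mul] at h
        rw [← h, map_add, map_sum]
        have hγ := γ.2.2.trans hdm
        refine add_mem (hE _ (coeff_genericSeries_mem_taylorField hγ)) (sum_mem fun β _ => ?_)
        rw [map_mul]
        exact mul_mem (hq β) (hE _ (coeff_monomial_mul_mem_taylorField β.1 hγ))
  rw [eq_top_iff]
  intro y _
  obtain ⟨a, b, -, rfl⟩ := IsFractionRing.div_surjective (A := ConeRing n d e) y
  exact div_mem (hB a) (hB b)

/-- Independent first order variations of the Taylor polynomial bound the dimension of the Taylor
variety from below. -/
theorem le_trdeg_coneAlgebra (hdm : d ≤ m) {r : ℕ} (a : Fin r → CoeffIdx n e)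
    (ha : LinearIndependent (ConeField n d e) (fun t (γ : Window n d m) =>
      algebraMap (ConeRing n d e) (ConeField n d e) (MvPowerSeries.coeff γ.1
        (MvPowerSeries.monomial (a t).1 1 * genericSeries n d e)))) :
    ((Nat.card (CoeffIdx n d) + r + 1 : ℕ) : Cardinal) ≤ Algebra.trdeg ℂ (coneAlgebra n d e m) := by
  have := Fintype.ofFinite (CoeffIdx n e)
  have h1 := trdeg_add_le_of_linear_system (E := taylorField n d e m) (L := ConeField n d e)
    (I := Window n d m) (r := r) _ (adjoin_denominator_eq_top (n := n) (e := e) hdm)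
    (fun β γ => ⟨_, coeff_monomial_mul_mem_taylorField β.1 γ.2.2⟩)
    (fun γ => -⟨_, coeff_genericSeries_mem_taylorField γ.2.2⟩) (by
      intro γ
      rw [finsum_eq_sum_of_fintype]
      have h := congrArg (MvPowerSeries.coeff γ.1) (unitSeries_mul_quotSeries
          (fun i : CoeffIdx n d => (MvPolynomial.X (some (Sum.inl i)) : ConeRing n d e))
          (fun i : CoeffIdx n e => MvPolynomial.X (some (Sum.inr i))))
      rw [coeff_unitSeries_of_lt _ γ.2.1, unitSeries_eq_one_add, add_mul, one_mul, map_add,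
          ← sum_mul_coeff_monomial_mul] at h
      have h' := congrArg (algebraMap (ConeRing n d e) (ConeField n d e)) (eq_neg_of_add_eq_zero_right h)
      rw [map_sum, map_neg] at h'
      simp only [map_mul] at h'
      rw [map_neg]
      exact h') a ha
  -- In the tower ℂ ⊆ `taylorField` ⊆ `ConeField` the total degree is the number of coefficients of
  -- P and Q plus one, and by `h1` the upper step is at most the number of coefficients of Q minus
  -- `r`.
  have h2 := trdeg_intermediateField_add_eq (taylorField n d e m)
  rw [trdeg_fractionRing_eq (k := ℂ) (B := ConeRing n d e) (L := ConeField n d e), trdeg_coneRing, ← trdeg_coneAlgebra] at h2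
  have hlt : ∀ {x : Cardinal} {k : ℕ}, x ≤ k → ∃ j : ℕ, x = j := fun {x k} hx =>
    Cardinal.lt_aleph0.1 (hx.trans_lt Cardinal.natCast_lt_aleph0)
  obtain ⟨x, hx⟩ := hlt (le_self_add.trans h2.le)
  obtain ⟨y, hy⟩ := hlt (le_add_self.trans h2.le)
  rw [hx, hy] at h2
  rw [hy] at h1
  rw [hx]
  norm_cast at h1 h2 ⊢
  omega

end Lower

end TaylorVariety

/-! ### Exchanging numerator and denominator -/

namespace TaylorVariety

section Symmetry

variable {n d e m : ℕ}

/-- Recursion on the degree: in f·g = 1 the coefficient of g at γ is a polynomial in coefficients of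
f and in coefficients of g of strictly smaller degree, because f has constant term 1. -/
theorem coeff_mem_of_mul_eq_one {k L : Type} [Field k] [Field L] [Algebra k L]
    (K : IntermediateField k L) {f g : MvPowerSeries (Fin n) L} (hfg : f * g = 1)
    (hf0 : MvPowerSeries.constantCoeff f = 1)
    (hf : ∀ γ : Fin n →₀ ℕ, γ.degree ≤ m → MvPowerSeries.coeff γ f ∈ K) (γ : Fin n →₀ ℕ)
    (hγ : γ.degree ≤ m) : MvPowerSeries.coeff γ g ∈ K := by
  classical
  induction hN : γ.degree using Nat.strong_induction_on generalizing γ with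
  | _ N ih =>
    have h := congrArg (MvPowerSeries.coeff γ) hfg
    rw [MvPowerSeries.coeff_mul, ← Finset.add_sum_erase _ _
      (show (0, γ) ∈ Finset.HasAntidiagonal.antidiagonal γ by simp),
      MvPowerSeries.coeff_zero_eq_constantCoeff_apply, hf0, one_mul, MvPowerSeries.coeff_one] at h
    rw [eq_sub_of_add_eq h]
    refine sub_mem ?_ (sum_mem fun p hp => ?_)
    · split_ifs
      · exact one_mem _
      · exact zero_mem _
    · obtain ⟨hne, hp⟩ := Finset.mem_erase.1 hp
      have hsum := Finset.HasAntidiagonal.mem_antidiagonal.1 hp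
      have hdeg := congrArg Finsupp.degree hsum
      rw [map_add] at hdeg
      have hpos : p.1.degree ≠ 0 := by
        intro h0
        rw [Finsupp.degree_eq_zero_iff] at h0
        apply hne
        rw [h0, zero_add] at hsum
        exact Prod.ext h0 hsum
      exact mul_mem (hf _ (by omega)) (ih p.2.degree (by omega) p.2 (by omega) rfl)

theorem adjoin_inverse_le {L : Type} [Field L] [Algebra ℂ L] {f g : MvPowerSeries (Fin n) L}
    (hfg : f * g = 1) (hf0 : MvPowerSeries.constantCoeff f = 1) {s : L} (hs : s ≠ 0) :
    IntermediateField.adjoin ℂ (Set.range fun γ : Exponent n m => s * MvPowerSeries.coeff γ.1 g)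
      ≤ IntermediateField.adjoin ℂ
        (Set.range fun γ : Exponent n m => s * MvPowerSeries.coeff γ.1 f) := by
  set K := IntermediateField.adjoin ℂ
    (Set.range fun γ : Exponent n m => s * MvPowerSeries.coeff γ.1 f) with hK
  have hmem : ∀ γ : Exponent n m, s * MvPowerSeries.coeff γ.1 f ∈ K := fun γ =>
    IntermediateField.subset_adjoin _ _ ⟨γ, rfl⟩
  have hsK : s ∈ K := by
    have := hmem ⟨0, by simp⟩
    rwa [MvPowerSeries.coeff_zero_eq_constantCoeff_apply, hf0, mul_one] at this
  have hf : ∀ γ : Fin n →₀ ℕ, γ.degree ≤ m → MvPowerSeries.coeff γ f ∈ K := by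
    intro γ hγ
    have := div_mem (hmem ⟨γ, hγ⟩) hsK
    rwa [mul_div_cancel_left₀ _ hs] at this
  rw [IntermediateField.adjoin_le_iff]
  rintro _ ⟨γ, rfl⟩
  exact mul_mem hsK (coeff_mem_of_mul_eq_one K hfg hf0 hf γ.1 γ.2)

theorem quotSeries_mul_quotSeries_swap {R : Type} [CommRing R] (p : CoeffIdx n d → R)
    (q : CoeffIdx n e → R) : quotSeries p q * quotSeries q p = 1 := by
  apply unitSeries_mul_left_cancel q
  apply unitSeries_mul_left_cancel p
  rw [← mul_assoc (unitSeries q), unitSeries_mul_quotSeries, mul_left_comm,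
    unitSeries_mul_quotSeries, mul_one, mul_comm]

variable (n d e) in
/-- Exchanging numerator and denominator. -/
noncomputable def swapHom : ConeRing n d e →ₐ[ℂ] ConeField n e d :=
  (IsScalarTower.toAlgHom ℂ (ConeRing n e d) (ConeField n e d)).comp
    (MvPolynomial.rename (Option.map Sum.swap))

theorem swapHom_injective : Function.Injective (swapHom n d e) := by
  refine (IsFractionRing.injective (ConeRing n e d) (ConeField n e d)).comp
    (MvPolynomial.rename_injective _ (Option.map_injective ?_))
  exact (Equiv.sumComm _ _).injective

/-- The exchange turns the generic series into its inverse. A series with constant term 1 and its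
inverse generate the same field by their scaled coefficients up to degree m. -/
theorem trdeg_coneAlgebra_swap :
    Algebra.trdeg ℂ (coneAlgebra n d e m) = Algebra.trdeg ℂ (coneAlgebra n e d m) := by
  rw [trdeg_coneAlgebra (d := e) (e := d), coneAlgebra,
    trdeg_adjoin_eq_of_injective (swapHom n d e) swapHom_injective, taylorField]
  set ι := algebraMap (ConeRing n e d) (ConeField n e d)
  set p : CoeffIdx n e → ConeField n e d := fun i => ι (MvPolynomial.X (some (Sum.inl i)))
  set q : CoeffIdx n d → ConeField n e d := fun i => ι (MvPolynomial.X (some (Sum.inr i)))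
  set s := ι (MvPolynomial.X none) with hs
  have hs0 : s ≠ 0 := by
    rw [hs, Ne, FaithfulSMul.algebraMap_eq_zero_iff]
    exact MvPolynomial.X_ne_zero _
  have h1 : swapHom n d e '' Set.range (coneCoord n d e m)
      = Set.range fun γ : Exponent n m => s * MvPowerSeries.coeff γ.1 (quotSeries q p) := by
    rw [← Set.range_comp]
    congr 1
    funext γ
    rw [Function.comp_apply, coneCoord, map_mul]
    congr 1
    · simp [swapHom, hs, ι]
    · change (swapHom n d e).toRingHom _ = _
      rw [← MvPowerSeries.coeff_map, genericSeries, map_quotSeries]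
      congr 3 <;>
      · funext i
        simp [swapHom, p, q, ι]
  have h2 : IsScalarTower.toAlgHom ℂ (ConeRing n e d) (ConeField n e d) ''
      Set.range (coneCoord n e d m)
      = Set.range fun γ : Exponent n m => s * MvPowerSeries.coeff γ.1 (quotSeries p q) := by
    rw [← Set.range_comp]
    congr 1
    funext γ
    rw [Function.comp_apply, coneCoord, map_mul]
    congr 1
    change ι _ = _
    rw [← MvPowerSeries.coeff_map, genericSeries, map_quotSeries]
  rw [h1, h2]
  have : IntermediateField.adjoin ℂ
        (Set.range fun γ : Exponent n m => s * MvPowerSeries.coeff γ.1 (quotSeries q p))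
      = IntermediateField.adjoin ℂ
        (Set.range fun γ : Exponent n m => s * MvPowerSeries.coeff γ.1 (quotSeries p q)) :=
    le_antisymm
      (adjoin_inverse_le (quotSeries_mul_quotSeries_swap p q) (constantCoeff_quotSeries p q) hs0)
      (adjoin_inverse_le (quotSeries_mul_quotSeries_swap q p) (constantCoeff_quotSeries q p) hs0)
  rw [this]

end Symmetry

end TaylorVariety

/-! ### Specialization to the field with two elements -/

section Specialization

variable {R k L J : Type} [CommRing R] [Field k] [Field L] [Finite J]

/-- Vectors over a ring that become independent after a surjective specialization to a field are
independent over every field containing the ring. -/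
theorem linearIndependent_of_specialization (π : R →+* k) (hπ : Function.Surjective π) (ι : R →+* L)
    (hι : Function.Injective ι) {r : ℕ} (v : Fin r → J → R)
    (h : LinearIndependent k (fun t j => π (v t j))) :
    LinearIndependent L (fun t j => ι (v t j)) := by
  classical
  have := Fintype.ofFinite J
  obtain ⟨g, hg⟩ : ∃ g : (J → k) →ₗ[k] (Fin r → k), ∀ t, g (fun j => π (v t j)) = Pi.single t 1 := by
    obtain ⟨g, hg⟩ := (Fintype.linearCombination k (fun t j => π (v t j))).exists_leftInverse_of_injective
      (LinearMap.ker_eq_bot.2 h.fintypeLinearCombination_injective)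
    refine ⟨g, fun t => ?_⟩
    have := LinearMap.congr_fun hg (Pi.single t 1)
    rw [LinearMap.comp_apply, Fintype.linearCombination_apply_single, one_smul] at this
    exact this
  choose G hG using fun (j : J) (t : Fin r) => hπ (g (Pi.single j 1) t)
  have hgsum : ∀ x t, g x t = ∑ j, x j * π (G j t) := by
    intro x t
    conv_lhs => rw [pi_eq_sum_univ' x]
    rw [map_sum, Finset.sum_apply]
    refine Finset.sum_congr rfl fun i _ => ?_
    rw [map_smul, hG]
    rfl
  -- `G` lifts a left inverse of the specialized family to `R`, so `N` specializes to the identity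
  -- matrix. Its determinant is therefore nonzero in `R`, and stays nonzero in `L`.
  let N : Matrix (Fin r) (Fin r) R := Matrix.of v * Matrix.of G
  have hN : N.map π = 1 := by
    ext t t'
    rw [Matrix.map_apply, Matrix.one_apply]
    change π (∑ j, v t j * G j t') = _
    rw [map_sum]
    simp only [map_mul]
    rw [← hgsum (fun j => π (v t j)) t', hg, Pi.single_apply]
    simp only [eq_comm]
  have hdet : N.det ≠ 0 := by
    intro h0
    have h1 := congrArg π h0
    rw [π.map_det, RingHom.mapMatrix_apply, hN, Matrix.det_one, map_zero] at h1
    exact one_ne_zero h1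
  have hdet' : (N.map ι).det ≠ 0 := by
    have h1 := ι.map_det N
    rw [RingHom.mapMatrix_apply] at h1
    rw [← h1]
    exact fun h0 => hdet (hι (h0.trans (map_zero ι).symm))
  rw [Fintype.linearIndependent_iff]
  intro c hc
  have hvec : Matrix.vecMul c (N.map ι) = 0 := by
    rw [show N.map ι = (Matrix.of v).map ι * (Matrix.of G).map ι from Matrix.map_mul,
      ← Matrix.vecMul_vecMul]
    have : Matrix.vecMul c ((Matrix.of v).map ι) = 0 := by
      funext j
      have := congrFun hc j
      simpa [Matrix.vecMul, dotProduct] using this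
    rw [this, Matrix.zero_vecMul]
  exact congrFun (Matrix.eq_zero_of_vecMul_eq_zero hdet' hvec)

theorem exists_subfamily_linearIndependent {K V α : Type} [Field K] [AddCommGroup V] [Module K V]
    [Finite α] (v : α → V) {r : ℕ} (hr : r ≤ Module.finrank K (Submodule.span K (Set.range v))) :
    ∃ a : Fin r → α, LinearIndependent K (fun t => v (a t)) := by
  obtain ⟨κ, a, ha, hspan, hli⟩ := exists_linearIndependent' K v
  have : Finite κ := Finite.of_injective a ha
  have := Fintype.ofFinite κ
  rw [← hspan, finrank_span_eq_card hli] at hr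
  let f : Fin r → κ := fun t => (Fintype.equivFin κ).symm (Fin.castLE hr t)
  refine ⟨fun t => a (f t), hli.comp f ?_⟩
  exact (Fintype.equivFin κ).symm.injective.comp (Fin.castLE_injective hr)

end Specialization

namespace TaylorVariety

variable {n d e m : ℕ}

/-- The coordinate ring over `ℤ` of the parameter space. -/
abbrev ParamRing (n d e : ℕ) : Type := MvPolynomial (Params n d e) ℤ

variable (n d e) in
/-- The quotient of the generic polynomials with integer coefficients. -/
noncomputable def integralSeries : MvPowerSeries (Fin n) (ParamRing n d e) :=
  quotSeries (fun i : CoeffIdx n d => MvPolynomial.X (Sum.inl i))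
    (fun i : CoeffIdx n e => MvPolynomial.X (Sum.inr i))

variable (n d e) in
/-- The inclusion of the integral parameter ring in the cone ring. -/
noncomputable def paramHom : ParamRing n d e →+* ConeRing n d e :=
  (MvPolynomial.rename some : _ →ₐ[ℂ] ConeRing n d e).toRingHom.comp
    (MvPolynomial.map (Int.castRingHom ℂ))

theorem paramHom_injective : Function.Injective (paramHom n d e) :=
  (MvPolynomial.rename_injective _ (Option.some_injective _)).comp
    (MvPolynomial.map_injective _ (RingHom.injective_int _))

theorem map_integralSeries :
    MvPowerSeries.map (paramHom n d e) (integralSeries n d e) = genericSeries n d e := by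
  rw [integralSeries, map_quotSeries, genericSeries]
  congr 1 <;>
  · funext i
    simp [paramHom]

/-- Specialization of the denominator to `1` and of the numerator to a polynomial with coefficients
in the field with two elements. -/
noncomputable def specialize (p : CoeffIdx n d → ZMod 2) : ParamRing n d e →+* ZMod 2 :=
  MvPolynomial.eval₂Hom (Int.castRingHom (ZMod 2)) (Sum.elim p 0)

theorem specialize_surjective (p : CoeffIdx n d → ZMod 2) :
    Function.Surjective (specialize (e := e) p) := by
  intro x
  obtain ⟨y, rfl⟩ := ZMod.intCast_surjective x
  exact ⟨MvPolynomial.C y, by simp [specialize]⟩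

theorem quotSeries_zero_right {R : Type} [CommRing R] (p : CoeffIdx n d → R) :
    quotSeries p (0 : CoeffIdx n e → R) = unitSeries p := by
  have h0 : unitSeries (0 : CoeffIdx n e → R) = 1 := by
    rw [unitSeries_eq_one_add]
    have : dirSeries (0 : CoeffIdx n e → R) = 0 := by
      ext γ
      rw [coeff_dirSeries]
      simp
    rw [this, add_zero]
  apply unitSeries_mul_left_cancel (0 : CoeffIdx n e → R)
  rw [unitSeries_mul_quotSeries, h0, one_mul]

/-- At denominator 1 the quotient is its numerator, so no power series has to be inverted in the
rank computation. -/
theorem map_specialize_integralSeries (p : CoeffIdx n d → ZMod 2) :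
    MvPowerSeries.map (specialize (e := e) p) (integralSeries n d e) = unitSeries p := by
  rw [integralSeries, map_quotSeries]
  have h1 : (fun i : CoeffIdx n d => specialize (e := e) p (MvPolynomial.X (Sum.inl i))) = p := by
    funext i; simp [specialize]
  have h2 : (fun i : CoeffIdx n e => specialize (e := e) p (MvPolynomial.X (Sum.inr i))) = 0 := by
    funext i; simp [specialize]
  rw [h1, h2, quotSeries_zero_right]

/-- A rank over the field with two elements bounds the dimension of the Taylor variety from
below. -/
theorem le_trdeg_of_finrank (hdm : d ≤ m) (p : CoeffIdx n d → ZMod 2) {r : ℕ}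
    (hr : r ≤ Module.finrank (ZMod 2) (Submodule.span (ZMod 2)
      (Set.range fun (β : CoeffIdx n e) (γ : Window n d m) =>
        MvPowerSeries.coeff γ.1 (MvPowerSeries.monomial β.1 1 * unitSeries p)))) :
    ((Nat.card (CoeffIdx n d) + r + 1 : ℕ) : Cardinal) ≤ Algebra.trdeg ℂ (coneAlgebra n d e m) := by
  obtain ⟨a, ha⟩ := exists_subfamily_linearIndependent _ hr
  refine le_trdeg_coneAlgebra hdm a ?_
  have h := linearIndependent_of_specialization (specialize (e := e) p) (specialize_surjective p)
    ((algebraMap (ConeRing n d e) (ConeField n d e)).comp (paramHom n d e))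
    ((IsFractionRing.injective (ConeRing n d e) (ConeField n d e)).comp paramHom_injective)
    (fun t (γ : Window n d m) => MvPowerSeries.coeff γ.1
      (MvPowerSeries.monomial (a t).1 1 * integralSeries n d e)) ?_
  · have hfun : (fun t (γ : Window n d m) =>
        ((algebraMap (ConeRing n d e) (ConeField n d e)).comp (paramHom n d e))
          (MvPowerSeries.coeff γ.1 (MvPowerSeries.monomial (a t).1 1 * integralSeries n d e))) =
        fun t (γ : Window n d m) => algebraMap (ConeRing n d e) (ConeField n d e)
          (MvPowerSeries.coeff γ.1 (MvPowerSeries.monomial (a t).1 1 * genericSeries n d e)) := by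
      funext t γ
      rw [RingHom.comp_apply, ← MvPowerSeries.coeff_map (paramHom n d e), map_mul,
        map_integralSeries, MvPowerSeries.map_monomial, map_one]
    rw [hfun] at h
    exact h
  · have hfun : (fun t (γ : Window n d m) => specialize (e := e) p
          (MvPowerSeries.coeff γ.1 (MvPowerSeries.monomial (a t).1 1 * integralSeries n d e))) =
        fun t (γ : Window n d m) => MvPowerSeries.coeff γ.1 (MvPowerSeries.monomial (a t).1 1 *
          unitSeries p) := by
      funext t γ
      rw [← MvPowerSeries.coeff_map, map_mul, map_specialize_integralSeries,
        MvPowerSeries.map_monomial, map_one]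
    rw [hfun]
    exact ha

/-- Directions over the integral parameter ring that are independent over the field with two
elements, and along which the Taylor polynomial does not change, bound the dimension of the Taylor
variety from above. -/
theorem trdeg_add_le_of_finrank (p : CoeffIdx n d → ZMod 2) {α : Type} [Finite α]
    (u : α → CoeffIdx n e → ParamRing n d e)
    (hu : ∀ t, ∀ γ : Fin n →₀ ℕ, d < γ.degree → γ.degree ≤ m →
      MvPowerSeries.coeff γ (dirSeries (u t) * integralSeries n d e) = 0) {r : ℕ}
    (hr : r ≤ Module.finrank (ZMod 2) (Submodule.span (ZMod 2)
      (Set.range fun t β => specialize (e := e) p (u t β)))) :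
    Algebra.trdeg ℂ (coneAlgebra n d e m) + r
      ≤ (Nat.card (CoeffIdx n d) + Nat.card (CoeffIdx n e) + 1 : ℕ) := by
  obtain ⟨a, ha⟩ := exists_subfamily_linearIndependent _ hr
  refine trdeg_coneAlgebra_add_le (fun t β => paramHom n d e (u (a t) β)) ?_ ?_
  · exact linearIndependent_of_specialization (specialize (e := e) p) (specialize_surjective p)
      ((algebraMap (ConeRing n d e) (ConeField n d e)).comp (paramHom n d e))
      ((IsFractionRing.injective (ConeRing n d e) (ConeField n d e)).comp paramHom_injective)
      (fun t => u (a t)) ha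
  · intro t γ h1 h2
    rw [← map_dirSeries, ← map_integralSeries, ← map_mul, MvPowerSeries.coeff_map, hu _ _ h1 h2,
      map_zero]

end TaylorVariety

/-! ### Gaussian elimination on binary vectors -/

namespace TaylorVariety

/-- The binary digits of a natural number, as a vector over the field with two elements. -/
def bits (v : ℕ) : ℕ → ZMod 2 := fun i => if v.testBit i then 1 else 0

theorem bits_apply_of_testBit_eq_false {v i : ℕ} (h : v.testBit i = false) : bits v i = 0 := by
  simp [bits, h]

theorem bits_zero : bits 0 = 0 := by
  funext i
  simp [bits]

theorem bits_xor (a b : ℕ) : bits (a ^^^ b) = bits a + bits b := by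
  funext i
  rw [Pi.add_apply, bits, bits, bits, Nat.testBit_xor]
  cases a.testBit i <;> cases b.testBit i <;> decide

theorem eq_zero_of_bits_eq_zero {v : ℕ} (h : bits v = 0) : v = 0 := by
  apply Nat.eq_of_testBit_eq
  intro i
  have := congrFun h i
  rw [bits] at this
  by_contra hv
  rw [Nat.zero_testBit, Bool.not_eq_false] at hv
  simp [hv] at this

theorem bits_shiftLeft_apply (v k i : ℕ) :
    bits (v <<< k) i = if k ≤ i then bits v (i - k) else 0 := by
  rw [bits, bits, Nat.testBit_shiftLeft]
  by_cases h : k ≤ i <;> simp [h]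

theorem bits_shiftRight_apply (v k i : ℕ) : bits (v >>> k) i = bits v (k + i) := by
  rw [bits, bits, Nat.testBit_shiftRight]

theorem bits_log2 {b : ℕ} (hb : b ≠ 0) : bits b b.log2 = 1 := by
  rw [bits, Nat.testBit_log2 hb, if_pos rfl]

/-- Since `b` has no digit above its leading one, `x` and `x ^^^ b` agree above that position and
differ at it; the smaller of the two is the one with digit zero there. Taking the minimum is thus
one elimination step. -/
theorem testBit_min_xor {b : ℕ} (hb : b ≠ 0) (x : ℕ) :
    (min x (x ^^^ b)).testBit b.log2 = false := by
  have hb1 : b.testBit b.log2 = true := Nat.testBit_log2 hb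
  have hb2 : ∀ j, b.log2 < j → b.testBit j = false := fun j hj =>
    Nat.testBit_eq_false_of_lt ((Nat.log2_lt hb).1 hj)
  cases hx : x.testBit b.log2
  · have : x < x ^^^ b := Nat.lt_of_testBit b.log2 hx (by simp [hx, hb1])
      (fun j hj => by simp [hb2 j hj])
    rw [min_eq_left this.le, hx]
  · have : x ^^^ b < x := Nat.lt_of_testBit b.log2 (by simp [hx, hb1]) hx
      (fun j hj => by simp [hb2 j hj])
    rw [min_eq_right this.le, Nat.testBit_xor, hx, hb1]
    rfl

/-- Reduction of a binary vector by a list of binary vectors, the last one first. -/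
noncomputable def reduceBy (bs : List ℕ) (v : ℕ) : ℕ :=
  -- With truncated subtraction, `x - (x - y)` is the minimum of `x` and `y`. Bare recursors and
  -- arithmetic primitives are used because the term is to be evaluated by the kernel.
  List.rec v (fun b _ x => Nat.sub x (Nat.sub x (Nat.xor x b))) bs

/-- Gaussian elimination of binary vectors, where `bs` is the echelon form found so far. -/
noncomputable def eliminate (rows : List ℕ) : List ℕ → List ℕ :=
  List.rec (fun bs => bs)
    (fun row _ ih bs => Nat.rec (ih bs) (fun k _ => ih (Nat.succ k :: bs)) (reduceBy bs row)) rows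

theorem reduceBy_cons (b : ℕ) (bs : List ℕ) (v : ℕ) :
    reduceBy (b :: bs) v = min (reduceBy bs v) (reduceBy bs v ^^^ b) := by
  have h : ∀ x y : ℕ, x - (x - y) = min x y := by omega
  exact h _ _

theorem eliminate_cons (row : ℕ) (rows bs : List ℕ) :
    eliminate (row :: rows) bs =
      if reduceBy bs row = 0 then eliminate rows bs
      else eliminate rows (reduceBy bs row :: bs) := by
  change (Nat.rec (eliminate rows bs) (fun k _ => eliminate rows (Nat.succ k :: bs))
    (reduceBy bs row) : List ℕ) = _
  cases reduceBy bs row <;> simp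

/-- A list of nonzero binary vectors in echelon form: every vector has digit zero at the leading
positions of the later ones. -/
def IsEchelon : List ℕ → Prop
  | [] => True
  | b :: bs => b ≠ 0 ∧ (∀ b' ∈ bs, b.testBit b'.log2 = false) ∧ IsEchelon bs

/-- The span of a list of binary vectors. -/
def bitSpan (bs : List ℕ) : Submodule (ZMod 2) (ℕ → ZMod 2) :=
  Submodule.span (ZMod 2) (bits '' {b | b ∈ bs})

theorem bits_mem_bitSpan {b : ℕ} {bs : List ℕ} (h : b ∈ bs) : bits b ∈ bitSpan bs :=
  Submodule.subset_span ⟨b, h, rfl⟩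

theorem bitSpan_cons (b : ℕ) (bs : List ℕ) :
    bitSpan (b :: bs) = Submodule.span (ZMod 2) {bits b} ⊔ bitSpan bs := by
  rw [bitSpan, bitSpan, ← Submodule.span_union]
  congr 1
  ext x
  simp [eq_comm]

instance (bs : List ℕ) : FiniteDimensional (ZMod 2) (bitSpan bs) :=
  FiniteDimensional.span_of_finite _ ((List.finite_toSet bs).image _)

/-- The older vectors, further back in the list, are applied first. A newer vector is already zero
at their leading positions, so adding it does not restore a digit that has been cleared. -/
theorem testBit_reduceBy {bs : List ℕ} (hbs : IsEchelon bs) (v : ℕ) :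
    ∀ b ∈ bs, (reduceBy bs v).testBit b.log2 = false := by
  induction bs with
  | nil => simp
  | cons b bs ih =>
    intro b' hb'
    rw [reduceBy_cons]
    rcases List.mem_cons.1 hb' with rfl | hb'
    · exact testBit_min_xor hbs.1 _
    · have h := ih hbs.2.2 b' hb'
      rcases min_choice (reduceBy bs v) (reduceBy bs v ^^^ b) with h1 | h1 <;> rw [h1]
      · exact h
      · rw [Nat.testBit_xor, h, hbs.2.1 b' hb']
        rfl

theorem bits_reduceBy_mem (bs : List ℕ) (v : ℕ) :
    bits (reduceBy bs v) ∈ Submodule.span (ZMod 2) {bits v} ⊔ bitSpan bs := by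
  induction bs with
  | nil => exact Submodule.mem_sup_left (Submodule.mem_span_singleton_self _)
  | cons b bs ih =>
    rw [reduceBy_cons, bitSpan_cons, sup_left_comm]
    have h := Submodule.mem_sup_right (S := Submodule.span (ZMod 2) {bits b}) ih
    rcases min_choice (reduceBy bs v) (reduceBy bs v ^^^ b) with h1 | h1 <;> rw [h1]
    · exact h
    · rw [bits_xor]
      exact Submodule.add_mem _ h
        (Submodule.mem_sup_left (Submodule.mem_span_singleton_self _))

/-- The head contributes nothing at the leading positions of the tail, so the tail part vanishes by
induction; the leading digit of the head then forces its coefficient to be zero. -/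
theorem eq_zero_of_mem_bitSpan {bs : List ℕ} (hbs : IsEchelon bs) {x : ℕ → ZMod 2}
    (hx : x ∈ bitSpan bs) (h0 : ∀ b ∈ bs, x b.log2 = 0) : x = 0 := by
  induction bs generalizing x with
  | nil => simpa [bitSpan] using hx
  | cons b bs ih =>
    rw [bitSpan_cons, Submodule.mem_sup] at hx
    obtain ⟨y, hy, z, hz, rfl⟩ := hx
    obtain ⟨c, rfl⟩ := Submodule.mem_span_singleton.1 hy
    have hz0 : z = 0 := by
      refine ih hbs.2.2 hz fun b' hb' => ?_
      have := h0 b' (List.mem_cons_of_mem _ hb')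
      rw [Pi.add_apply, Pi.smul_apply, bits_apply_of_testBit_eq_false (hbs.2.1 b' hb'),
        smul_zero, zero_add] at this
      exact this
    subst hz0
    have := h0 b List.mem_cons_self
    rw [Pi.add_apply, Pi.smul_apply, bits_log2 hbs.1, Pi.zero_apply, add_zero, smul_eq_mul,
      mul_one] at this
    rw [this, zero_smul, add_zero]

theorem length_le_finrank_bitSpan {bs : List ℕ} (hbs : IsEchelon bs) :
    bs.length ≤ Module.finrank (ZMod 2) (bitSpan bs) := by
  induction bs with
  | nil => simp
  | cons b bs ih =>
    have hlt : bitSpan bs < bitSpan (b :: bs) := by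
      refine lt_of_le_of_ne (by rw [bitSpan_cons]; exact le_sup_right) fun heq => ?_
      have hb := bits_mem_bitSpan (List.mem_cons_self (a := b) (l := bs))
      rw [← heq] at hb
      exact hbs.1 (eq_zero_of_bits_eq_zero (eq_zero_of_mem_bitSpan hbs.2.2 hb fun b' hb' =>
        bits_apply_of_testBit_eq_false (hbs.2.1 b' hb')))
    exact (ih hbs.2.2).trans_lt (Submodule.finrank_lt_finrank_of_lt hlt)

theorem isEchelon_eliminate (rows : List ℕ) {bs : List ℕ} (hbs : IsEchelon bs) :
    IsEchelon (eliminate rows bs) ∧ bitSpan (eliminate rows bs) ≤ bitSpan rows ⊔ bitSpan bs := by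
  induction rows generalizing bs with
  | nil => exact ⟨hbs, le_sup_right⟩
  | cons row rows ih =>
    rw [eliminate_cons, bitSpan_cons]
    split_ifs with h
    · exact ⟨(ih hbs).1, (ih hbs).2.trans (sup_le_sup_right le_sup_right _)⟩
    · have h1 : IsEchelon (reduceBy bs row :: bs) := ⟨h, testBit_reduceBy hbs row, hbs⟩
      refine ⟨(ih h1).1, (ih h1).2.trans ?_⟩
      rw [bitSpan_cons]
      refine sup_le (le_sup_right.trans le_sup_left) (sup_le ?_ le_sup_right)
      rw [Submodule.span_singleton_le_iff_mem]
      exact SetLike.le_def.1 (sup_le_sup_right le_sup_left _) (bits_reduceBy_mem bs row)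

theorem length_eliminate_le_finrank (rows : List ℕ) :
    (eliminate rows []).length ≤ Module.finrank (ZMod 2) (bitSpan rows) := by
  have h := isEchelon_eliminate rows (bs := []) trivial
  refine (length_le_finrank_bitSpan h.1).trans (Submodule.finrank_mono ?_)
  refine h.2.trans (sup_le le_rfl ?_)
  simp [bitSpan]

end TaylorVariety

/-! ### Encoding monomials and polynomials as natural numbers -/

namespace TaylorVariety

/-- Evaluation of `f` at the normal form of a natural number. -/
noncomputable def strict {α : Type} (f : ℕ → α) (v : ℕ) : α :=
  Nat.rec (f 0) (fun k _ => f (Nat.succ k)) v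

theorem strict_eq {α : Type} (f : ℕ → α) (v : ℕ) : strict f v = f v := by
  cases v <;> rfl

/-- The invertible linear substitution `x ↦ x + (x >>> s)` of binary vectors, for several `s`. -/
noncomputable def foldBy (l : List ℕ) (x : ℕ) : ℕ :=
  List.rec x (fun s _ x => strict (fun x => Nat.xor x (Nat.shiftRight x s)) x) l

/-- A hash of binary vectors that is linear and invertible. -/
noncomputable def fold (x : ℕ) : ℕ :=
  -- Over the field with two elements the product of 1 + T^s for these s, with T the shift down by
  -- one digit, is the sum of T^(32j) for j < 1024. On numbers of at most 32768 digits the lowest 32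
  -- digits thus become the sum of all blocks of 32 digits. The rank bound uses only linearity.
  foldBy [32, 64, 128, 256, 512, 1024, 2048, 4096, 8192, 16384] x

/-- The effect of `foldBy` on binary vectors. -/
def foldMap : List ℕ → (ℕ → ZMod 2) →ₗ[ZMod 2] (ℕ → ZMod 2)
  | [] => LinearMap.id
  | s :: l => (LinearMap.id + LinearMap.funLeft (ZMod 2) (ZMod 2) (s + ·)) ∘ₗ foldMap l

theorem exists_linearMap_bits_fold :
    ∃ Θ : (ℕ → ZMod 2) →ₗ[ZMod 2] (ℕ → ZMod 2), ∀ x, bits (fold x) = Θ (bits x) := by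
  have h : ∀ (l : List ℕ) (x : ℕ), bits (foldBy l x) = foldMap l (bits x) := by
    intro l x
    induction l with
    | nil => rfl
    | cons s l ih =>
      rw [foldMap, LinearMap.comp_apply, ← ih]
      change bits (strict (fun x => x ^^^ (x >>> s)) (foldBy l x)) = _
      rw [strict_eq, bits_xor, LinearMap.add_apply, LinearMap.id_apply]
      congr 1
      funext i
      rw [LinearMap.funLeft_apply, bits_shiftRight_apply]
  exact ⟨foldMap [32, 64, 128, 256, 512, 1024, 2048, 4096, 8192, 16384], fun x => h _ x⟩

/-- The weight of an exponent vector for given weights of the variables. -/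
def code {n : ℕ} (wt : ℕ → ℕ) (β : Fin n →₀ ℕ) : ℕ := ∑ i : Fin n, β i * wt i

theorem code_add {n : ℕ} (wt : ℕ → ℕ) (β γ : Fin n →₀ ℕ) :
    code wt (β + γ) = code wt β + code wt γ := by
  simp [code, add_mul, Finset.sum_add_distrib]

theorem code_zero {n : ℕ} (wt : ℕ → ℕ) : code wt (0 : Fin n →₀ ℕ) = 0 := by
  simp [code]

theorem code_single {n : ℕ} (wt : ℕ → ℕ) (i : Fin n) :
    code wt (Finsupp.single i 1) = wt i := by
  rw [code, Finset.sum_eq_single i]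
  · simp
  · intro j _ hj
    rw [Finsupp.single_eq_of_ne hj, zero_mul]
  · simp

/-- The weights of the monomials of degree `j`. -/
def IsCode (n : ℕ) (wt : ℕ → ℕ) (j k : ℕ) : Prop :=
  ∃ β : Fin n →₀ ℕ, β.degree = j ∧ code wt β = k

theorem isCode_zero (n : ℕ) (wt : ℕ → ℕ) : IsCode n wt 0 0 := ⟨0, by simp, code_zero wt⟩

theorem IsCode.add_weight {n : ℕ} {wt : ℕ → ℕ} {j k i : ℕ} (h : IsCode n wt j k) (hi : i < n) :
    IsCode n wt (j + 1) (k + wt i) := by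
  obtain ⟨β, rfl, rfl⟩ := h
  exact ⟨β + Finsupp.single ⟨i, hi⟩ 1, by simp, by rw [code_add, code_single]⟩

section Tables

/-- Prepend the elements of `L`, shifted by `w`, to `M`. -/
noncomputable def mapAdd (w : ℕ) (L : List ℕ) (M : List ℕ) : List ℕ :=
  List.rec M (fun k _ ih => strict (fun x => x :: ih) (Nat.add k w)) L

theorem mapAdd_eq (w : ℕ) (L M : List ℕ) : mapAdd w L M = L.map (· + w) ++ M := by
  induction L with
  | nil => rfl
  | cons k L ih =>
    change strict (fun x => x :: mapAdd w L M) (k + w) = _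
    rw [strict_eq, ih]
    rfl

/-- Given the weights of the monomials in some variables, degree by degree, those after adding a
variable of weight `w`. -/
noncomputable def addVar (w : ℕ) (T : List (List ℕ)) : List ℕ → List (List ℕ) :=
  List.rec (fun _ => []) (fun L _ ih prev => (fun new => new :: ih new) (mapAdd w prev L)) T

/-- The analogue of `addVar` for sets of weights encoded as bit masks. -/
noncomputable def addVarMask (w : ℕ) (T : List ℕ) : ℕ → List ℕ :=
  List.rec (fun _ => [])
    (fun M _ ih prev => strict (fun new => new :: ih new) (Nat.lor M (Nat.shiftLeft prev w))) T

/-- The weights of the monomials of degree at most `e`, degree by degree. -/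
noncomputable def codeTable (wt : ℕ → ℕ) (e : ℕ) (n : ℕ) : List (List ℕ) :=
  Nat.rec ([0] :: List.replicate e []) (fun i ih => strict (fun w => addVar w ih []) (wt i)) n

/-- The analogue of `codeTable` for bit masks. -/
noncomputable def maskTable (wt : ℕ → ℕ) (d : ℕ) (n : ℕ) : List ℕ :=
  Nat.rec (1 :: List.replicate d 0) (fun i ih => strict (fun w => addVarMask w ih 0) (wt i)) n

/-- The entries of a list are lists of weights of monomials of degrees `j, j + 1, …`. -/
def AreCodes (n : ℕ) (wt : ℕ → ℕ) : ℕ → List (List ℕ) → Prop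
  | _, [] => True
  | j, L :: T => (∀ k ∈ L, IsCode n wt j k) ∧ AreCodes n wt (j + 1) T

/-- The entries of a list are bit masks of weights of monomials of degrees `j, j + 1, …`. -/
def AreMasks (n : ℕ) (wt : ℕ → ℕ) : ℕ → List ℕ → Prop
  | _, [] => True
  | j, M :: T => (∀ k, M.testBit k = true → IsCode n wt j k) ∧ AreMasks n wt (j + 1) T

variable {n : ℕ} {wt : ℕ → ℕ}

/-- A monomial of degree j either avoids the added variable or is that variable times a monomial of
degree j − 1, and `prev` carries the extended list of degree j − 1. Completeness of the lists is not
needed: a missing monomial can only lower the computed rank. -/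
theorem areCodes_addVar {i : ℕ} (hi : i < n) {T : List (List ℕ)} {j : ℕ} {prev : List ℕ}
    (hT : AreCodes n wt j T) (hp : ∀ k ∈ prev, IsCode n wt j (k + wt i)) :
    AreCodes n wt j (addVar (wt i) T prev) ∧ (addVar (wt i) T prev).length = T.length := by
  induction T generalizing j prev with
  | nil => exact ⟨trivial, rfl⟩
  | cons L T ih =>
    change AreCodes n wt j (mapAdd (wt i) prev L :: addVar (wt i) T (mapAdd (wt i) prev L)) ∧
      (mapAdd (wt i) prev L :: addVar (wt i) T (mapAdd (wt i) prev L)).length = _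
    have h : ∀ k ∈ mapAdd (wt i) prev L, IsCode n wt j k := by
      intro k hk
      rw [mapAdd_eq, List.mem_append, List.mem_map] at hk
      rcases hk with ⟨k, hk, rfl⟩ | hk
      · exact hp k hk
      · exact hT.1 k hk
    have h' := ih hT.2 (prev := mapAdd (wt i) prev L) fun k hk => (h k hk).add_weight hi
    exact ⟨⟨h, h'.1⟩, by rw [List.length_cons, List.length_cons, h'.2]⟩

theorem areMasks_addVarMask {i : ℕ} (hi : i < n) {T : List ℕ} {j : ℕ} {prev : ℕ}
    (hT : AreMasks n wt j T) (hp : ∀ k, prev.testBit k = true → IsCode n wt j (k + wt i)) :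
    AreMasks n wt j (addVarMask (wt i) T prev) ∧
      (addVarMask (wt i) T prev).length = T.length := by
  induction T generalizing j prev with
  | nil => exact ⟨trivial, rfl⟩
  | cons M T ih =>
    have he : addVarMask (wt i) (M :: T) prev =
        (M ||| prev <<< wt i) :: addVarMask (wt i) T (M ||| prev <<< wt i) :=
      strict_eq (fun new => new :: addVarMask (wt i) T new) (M ||| prev <<< wt i)
    rw [he]
    have h : ∀ k, (M ||| prev <<< wt i).testBit k = true → IsCode n wt j k := by
      intro k hk
      rw [Nat.testBit_or, Bool.or_eq_true, Nat.testBit_shiftLeft, Bool.and_eq_true,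
        decide_eq_true_iff] at hk
      rcases hk with hk | ⟨hk1, hk2⟩
      · exact hT.1 k hk
      · have := hp _ hk2
        rwa [Nat.sub_add_cancel hk1] at this
    have h' := ih hT.2 (prev := M ||| prev <<< wt i) fun k hk => (h k hk).add_weight hi
    exact ⟨⟨h, h'.1⟩, by rw [List.length_cons, List.length_cons, h'.2]⟩

theorem areCodes_codeTable (e : ℕ) {k : ℕ} (hk : k ≤ n) :
    AreCodes n wt 0 (codeTable wt e k) ∧ (codeTable wt e k).length = e + 1 := by
  induction k with
  | zero =>
    refine ⟨⟨by simpa using isCode_zero n wt, ?_⟩, by simp [codeTable]⟩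
    generalize 0 + 1 = j
    induction e generalizing j with
    | zero => trivial
    | succ e ih => exact ⟨by simp, ih _⟩
  | succ i ih =>
    have he : codeTable wt e (i + 1) = addVar (wt i) (codeTable wt e i) [] :=
      strict_eq (fun w => addVar w (codeTable wt e i) []) (wt i)
    have h := ih (by omega)
    have h' := areCodes_addVar (prev := []) (show i < n by omega) h.1 (by simp)
    rw [he]
    exact ⟨h'.1, h'.2.trans h.2⟩

theorem areMasks_maskTable (d : ℕ) {k : ℕ} (hk : k ≤ n) :
    AreMasks n wt 0 (maskTable wt d k) ∧ (maskTable wt d k).length = d + 1 := by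
  induction k with
  | zero =>
    refine ⟨⟨fun k hk => ?_, ?_⟩, by simp [maskTable]⟩
    · rw [Nat.testBit_one_eq_true_iff_self_eq_zero] at hk
      rw [hk]
      exact isCode_zero n wt
    · generalize 0 + 1 = j
      induction d generalizing j with
      | zero => trivial
      | succ e ih => exact ⟨by simp, ih _⟩
  | succ i ih =>
    have he : maskTable wt d (i + 1) = addVarMask (wt i) (maskTable wt d i) 0 :=
      strict_eq (fun w => addVarMask w (maskTable wt d i) 0) (wt i)
    have h := ih (by omega)
    have h' := areMasks_addVarMask (prev := 0) (show i < n by omega) h.1 (by simp)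
    rw [he]
    exact ⟨h'.1, h'.2.trans h.2⟩

theorem AreCodes.isCode {T : List (List ℕ)} {j : ℕ} (h : AreCodes n wt j T) (t k : ℕ)
    (hk : k ∈ T.getD t []) : IsCode n wt (j + t) k := by
  induction T generalizing j t with
  | nil => simp at hk
  | cons L T ih =>
    cases t with
    | zero => exact h.1 k (by simpa using hk)
    | succ t =>
      rw [show j + (t + 1) = j + 1 + t by omega]
      exact ih h.2 t (by simpa using hk)

/-- The homogeneous components, as bit masks, of a pseudorandom polynomial with constant
coefficient `1`. -/
noncomputable def maskedComps (S : ℕ) (Ms : List ℕ) : ℕ → List ℕ :=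
  List.rec (fun _ => []) (fun M _ ih i => strict (fun x => x :: ih (Nat.succ i))
    (Nat.land (Nat.shiftRight S (Nat.mul 37 i)) M)) Ms

theorem areMasks_maskedComps (S : ℕ) {Ms : List ℕ} {j : ℕ} (h : AreMasks n wt j Ms) (i : ℕ) :
    AreMasks n wt j (maskedComps S Ms i) ∧ (maskedComps S Ms i).length = Ms.length := by
  induction Ms generalizing j i with
  | nil => exact ⟨trivial, rfl⟩
  | cons M Ms ih =>
    have he : maskedComps S (M :: Ms) i =
        ((S >>> (37 * i)) &&& M) :: maskedComps S Ms (i + 1) :=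
      strict_eq (fun x => x :: maskedComps S Ms (i + 1)) _
    rw [he]
    have h' := ih h.2 (i + 1)
    refine ⟨⟨fun k hk => h.1 k ?_, h'.1⟩, by rw [List.length_cons, List.length_cons, h'.2]⟩
    rw [Nat.testBit_and, Bool.and_eq_true] at hk
    exact hk.2

theorem AreMasks.isCode {T : List ℕ} {j : ℕ} (h : AreMasks n wt j T) (t k : ℕ)
    (hk : (T.getD t 0).testBit k = true) : IsCode n wt (j + t) k := by
  induction T generalizing j t with
  | nil => simp at hk
  | cons L T ih =>
    cases t with
    | zero => exact h.1 k (by simpa using hk)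
    | succ t =>
      rw [show j + (t + 1) = j + 1 + t by omega]
      exact ih h.2 t (by simpa using hk)

/-- The homogeneous components of degree at most `d` of a pseudorandom polynomial with constant
coefficient `1`. -/
noncomputable def comps (wt : ℕ → ℕ) (S d n : ℕ) : List ℕ :=
  1 :: maskedComps S (maskTable wt d n).tail 1

theorem areMasks_comps (S d : ℕ) :
    AreMasks n wt 0 (comps wt S d n) ∧ (comps wt S d n).length = d + 1 := by
  have h := areMasks_maskTable (n := n) (wt := wt) d le_rfl
  have ht : AreMasks n wt 1 (maskTable wt d n).tail := by
    revert h
    cases maskTable wt d n with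
    | nil => exact fun _ => trivial
    | cons M T => exact fun h => h.1.2
  have h' := areMasks_maskedComps S ht 1
  refine ⟨⟨fun k hk => ?_, h'.1⟩, ?_⟩
  · rw [Nat.testBit_one_eq_true_iff_self_eq_zero] at hk
    rw [hk]
    exact isCode_zero n wt
  · rw [comps, List.length_cons, h'.2, List.length_tail, h.2, Nat.add_sub_cancel]

end Tables

end TaylorVariety

/-! ### Soundness of the encoding -/

namespace TaylorVariety

variable {n d e m : ℕ}

section CodeMap

open Classical in
/-- The linear map from polynomials to binary vectors that sends a monomial to the unit vector of
its weight if its exponent lies in `I`, and to zero otherwise. -/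
noncomputable def codeMap (wt : ℕ → ℕ) (I : Set (Fin n →₀ ℕ)) :
    MvPolynomial (Fin n) (ZMod 2) →ₗ[ZMod 2] (ℕ → ZMod 2) :=
  (MvPolynomial.basisMonomials (Fin n) (ZMod 2)).constr (ZMod 2)
    (fun γ => if γ ∈ I then Pi.single (code wt γ) 1 else 0)

variable (wt : ℕ → ℕ) (I : Set (Fin n →₀ ℕ))

open Classical in
theorem codeMap_monomial (γ : Fin n →₀ ℕ) :
    codeMap wt I (MvPolynomial.monomial γ 1) = if γ ∈ I then Pi.single (code wt γ) 1 else 0 := by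
  have := (MvPolynomial.basisMonomials (Fin n) (ZMod 2)).constr_basis (ZMod 2)
    (fun γ => if γ ∈ I then (Pi.single (code wt γ) 1 : ℕ → ZMod 2) else 0) γ
  rwa [MvPolynomial.coe_basisMonomials] at this

/-- The image of a polynomial under `codeMap` depends linearly on the coefficients in `I`. -/
theorem exists_linearMap_codeMap [Finite I] :
    ∃ Λ : (I → ZMod 2) →ₗ[ZMod 2] (ℕ → ZMod 2), ∀ R : MvPolynomial (Fin n) (ZMod 2),
      codeMap wt I R = Λ (fun γ => R.coeff γ.1) := by
  classical
  have := Fintype.ofFinite I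
  let Λ : (I → ZMod 2) →ₗ[ZMod 2] (ℕ → ZMod 2) :=
    Fintype.linearCombination (ZMod 2) (fun γ : I => Pi.single (code wt γ.1) 1)
  let κ : MvPolynomial (Fin n) (ZMod 2) →ₗ[ZMod 2] (I → ZMod 2) :=
    LinearMap.pi fun γ => MvPolynomial.lcoeff (ZMod 2) γ.1
  refine ⟨Λ, fun R => ?_⟩
  suffices codeMap wt I = Λ ∘ₗ κ from LinearMap.congr_fun this R
  refine (MvPolynomial.basisMonomials (Fin n) (ZMod 2)).ext fun γ => ?_
  rw [MvPolynomial.coe_basisMonomials, codeMap_monomial, LinearMap.comp_apply,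
    Fintype.linearCombination_apply]
  split_ifs with hγ
  · rw [Finset.sum_eq_single ⟨γ, hγ⟩]
    · simp [κ]
    · intro δ _ hδ
      have : γ ≠ δ.1 := fun h => hδ (Subtype.ext h.symm)
      simp [κ, MvPolynomial.coeff_monomial, this]
    · simp
  · symm
    refine Finset.sum_eq_zero fun δ _ => ?_
    have : γ ≠ δ.1 := fun h => hγ (h ▸ δ.2)
    simp [κ, MvPolynomial.coeff_monomial, this]

theorem sum_range_single_eq_bits (v : ℕ) (k : ℕ) :
    (∑ i ∈ Finset.range (v + 1), if v.testBit i then (Pi.single (i + k) 1 : ℕ → ZMod 2) else 0) =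
      bits (v <<< k) := by
  classical
  funext j
  rw [Finset.sum_apply, bits_shiftLeft_apply]
  have h : ∀ i, (if v.testBit i then (Pi.single (i + k) 1 : ℕ → ZMod 2) else 0) j =
      if k ≤ j ∧ i = j - k then bits v i else 0 := by
    intro i
    rw [bits]
    by_cases hi : v.testBit i
    · simp only [hi, if_true, Pi.single_apply]
      congr 1
      simp only [eq_iff_iff]
      omega
    · simp [hi]
  simp only [h]
  split_ifs with hk
  · simp only [true_and, Finset.sum_ite_eq', Finset.mem_range, hk]
    split_ifs with hj
    · rfl
    · refine (bits_apply_of_testBit_eq_false (Nat.testBit_eq_false_of_lt ?_)).symm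
      exact lt_of_lt_of_le (Nat.lt_two_pow_self) (Nat.pow_le_pow_right (by norm_num) (by omega))
  · simp [hk]

/-- One monomial is chosen for each nonzero digit, so distinct terms have distinct weights even if
the weight function is not injective. Multiplication by a monomial then shifts all digits by its
weight. -/
theorem exists_isHomogeneous_codeMap {i C : ℕ} (hC : ∀ k, C.testBit k = true → IsCode n wt i k) :
    ∃ P : MvPolynomial (Fin n) (ZMod 2), P.IsHomogeneous i ∧
      ∀ (I : Set (Fin n →₀ ℕ)) (β : Fin n →₀ ℕ), (∀ γ, γ.degree = i → β + γ ∈ I) →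
        codeMap wt I (MvPolynomial.monomial β 1 * P) = bits (C <<< code wt β) := by
  classical
  choose! γ hγ1 hγ2 using hC
  refine ⟨∑ k ∈ Finset.range (C + 1), if C.testBit k then MvPolynomial.monomial (γ k) 1 else 0,
    MvPolynomial.IsHomogeneous.sum _ _ _ fun k _ => ?_, fun I β hI => ?_⟩
  · split_ifs with hk
    · exact MvPolynomial.isHomogeneous_monomial _ (hγ1 k hk)
    · exact MvPolynomial.isHomogeneous_zero _ _ _
  · rw [Finset.mul_sum, map_sum, ← sum_range_single_eq_bits]
    refine Finset.sum_congr rfl fun k _ => ?_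
    split_ifs with hk
    · rw [MvPolynomial.monomial_mul, one_mul, codeMap_monomial, if_pos (hI _ (hγ1 k hk)), code_add,
        hγ2 k hk, add_comm]
    · rw [mul_zero, map_zero]

theorem codeMap_monomial_mul_eq_zero {i : ℕ} {P : MvPolynomial (Fin n) (ZMod 2)}
    (hP : P.IsHomogeneous i) (β : Fin n →₀ ℕ) (hI : ∀ γ, γ.degree = i → β + γ ∉ I) :
    codeMap wt I (MvPolynomial.monomial β 1 * P) = 0 := by
  classical
  rw [P.as_sum, Finset.mul_sum, map_sum]
  refine Finset.sum_eq_zero fun γ hγ => ?_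
  have hdeg : γ.degree = i := by
    by_contra h
    exact MvPolynomial.mem_support_iff.1 hγ (hP.coeff_eq_zero h)
  rw [MvPolynomial.monomial_mul, one_mul]
  have : MvPolynomial.monomial (β + γ) (P.coeff γ) =
      P.coeff γ • MvPolynomial.monomial (β + γ) (1 : ZMod 2) := by
    rw [MvPolynomial.smul_monomial, smul_eq_mul, mul_one]
  rw [this, map_smul, codeMap_monomial, if_neg (hI γ hdeg), smul_zero]

end CodeMap

section Rows

/-- The sum of those components from a list, in degrees `i, i + 1, …`, that are moved to a degree
between `d + 1` and `m` by multiplication with a monomial of degree `j`. -/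
noncomputable def windowXor (d m j : ℕ) (C : List ℕ) : ℕ → ℕ :=
  List.rec (fun _ => 0) (fun c _ ih i =>
    if d < i + j ∧ i + j ≤ m then Nat.xor c (ih (Nat.succ i)) else ih (Nat.succ i)) C

theorem bits_windowXor (d m j : ℕ) (C : List ℕ) (i k : ℕ) :
    bits (windowXor d m j C i <<< k) = ∑ t ∈ Finset.range C.length,
      if d < i + t + j ∧ i + t + j ≤ m then bits (C.getD t 0 <<< k) else 0 := by
  induction C generalizing i with
  | nil =>
    change bits (0 <<< k) = _
    rw [Nat.zero_shiftLeft, bits_zero]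
    rfl
  | cons c C ih =>
    rw [List.length_cons, Finset.sum_range_succ']
    have h : ∀ t, (if d < i + (t + 1) + j ∧ i + (t + 1) + j ≤ m
        then bits ((c :: C).getD (t + 1) 0 <<< k) else 0) =
        if d < i + 1 + t + j ∧ i + 1 + t + j ≤ m then bits (C.getD t 0 <<< k) else 0 := by
      intro t
      rw [show i + (t + 1) = i + 1 + t by omega, List.getD_cons_succ]
    simp only [h]
    rw [← ih (i + 1), List.getD_cons_zero, add_zero]
    change bits ((if d < i + j ∧ i + j ≤ m then c ^^^ windowXor d m j C (i + 1)
      else windowXor d m j C (i + 1)) <<< k) = _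
    split_ifs
    · rw [Nat.shiftLeft_xor_distrib, bits_xor, add_comm]
    · rw [add_zero]

/-- Prepend to `M` the products of `S` with the monomials of the weights in `L`. -/
noncomputable def shiftAll (S : ℕ) (L : List ℕ) (M : List ℕ) : List ℕ :=
  List.rec M (fun k _ ih => strict (fun x => x :: ih) (fold (Nat.shiftLeft S k))) L

theorem mem_shiftAll {S : ℕ} {L M : List ℕ} {r : ℕ} (h : r ∈ shiftAll S L M) :
    r ∈ M ∨ ∃ k ∈ L, r = fold (S <<< k) := by
  induction L with
  | nil => exact Or.inl h
  | cons k L ih =>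
    change r ∈ strict (fun x => x :: shiftAll S L M) (fold (S <<< k)) at h
    rw [strict_eq, List.mem_cons] at h
    rcases h with h | h
    · exact Or.inr ⟨k, List.mem_cons_self, h⟩
    · rcases ih h with h | ⟨k', hk', h⟩
      · exact Or.inl h
      · exact Or.inr ⟨k', List.mem_cons_of_mem _ hk', h⟩

/-- The parts in degrees `d + 1, …, m` of the products of a polynomial with components `C` with the
monomials of weights `T`, in degrees `j, j + 1, …`. -/
noncomputable def rowsFrom (d m : ℕ) (C : List ℕ) (T : List (List ℕ)) : ℕ → List ℕ :=
  List.rec (fun _ => []) (fun L _ ih j => strict (fun S => shiftAll S L (ih (Nat.succ j)))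
    (windowXor d m j C 0)) T

theorem mem_rowsFrom {wt : ℕ → ℕ} {C : List ℕ} {T : List (List ℕ)} {j r : ℕ}
    (hT : AreCodes n wt j T) (h : r ∈ rowsFrom d m C T j) :
    ∃ β : Fin n →₀ ℕ, j ≤ β.degree ∧ β.degree < j + T.length ∧
      r = fold (windowXor d m β.degree C 0 <<< code wt β) := by
  induction T generalizing j with
  | nil => simp [rowsFrom] at h
  | cons L T ih =>
    change r ∈ strict (fun S => shiftAll S L (rowsFrom d m C T (j + 1)))
      (windowXor d m j C 0) at h
    rw [strict_eq] at h
    rcases mem_shiftAll h with h | ⟨k, hk, rfl⟩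
    · obtain ⟨β, h1, h2, h3⟩ := ih hT.2 h
      exact ⟨β, by omega, by rw [List.length_cons]; omega, h3⟩
    · obtain ⟨β, rfl, rfl⟩ := hT.1 k hk
      exact ⟨β, le_rfl, by simp, rfl⟩

/-- A rank computation on bit vectors bounds the rank of a family of vectors. -/
theorem length_eliminate_le_finrank_of_rows {V α : Type} [AddCommGroup V] [Module (ZMod 2) V]
    [Finite α] (v : α → V) (Λ : V →ₗ[ZMod 2] (ℕ → ZMod 2)) {rows : List ℕ}
    (h : ∀ r ∈ rows, ∃ a b, r = fold b ∧ Λ (v a) = bits b) :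
    (eliminate rows []).length ≤
      Module.finrank (ZMod 2) (Submodule.span (ZMod 2) (Set.range v)) := by
  obtain ⟨Θ, hΘ⟩ := exists_linearMap_bits_fold
  have : FiniteDimensional (ZMod 2) (Submodule.span (ZMod 2) (Set.range v)) :=
    FiniteDimensional.span_of_finite _ (Set.finite_range v)
  refine (length_eliminate_le_finrank rows).trans (le_trans (Submodule.finrank_mono ?_)
    (Submodule.finrank_map_le (Θ ∘ₗ Λ) (Submodule.span (ZMod 2) (Set.range v))))
  rw [bitSpan, Submodule.span_le]
  rintro _ ⟨r, hr, rfl⟩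
  obtain ⟨a, b, rfl, hab⟩ := h r hr
  exact ⟨v a, Submodule.subset_span ⟨a, rfl⟩, by rw [LinearMap.comp_apply, hab, hΘ]⟩

end Rows

section Witness

/-- There is a polynomial with given components as bit masks. -/
theorem exists_components (wt : ℕ → ℕ) {C : List ℕ} (hC : AreMasks n wt 0 C)
    (hC0 : C.getD 0 0 = 1) :
    ∃ (P : ℕ → MvPolynomial (Fin n) (ZMod 2)) (p : CoeffIdx n d → ZMod 2),
      (∀ i, (P i).IsHomogeneous i) ∧
      unitSeries p = ((∑ i ∈ Finset.range (d + 1), P i : MvPolynomial (Fin n) (ZMod 2)) :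
        MvPowerSeries (Fin n) (ZMod 2)) ∧
      ∀ (i : ℕ) (I : Set (Fin n →₀ ℕ)) (β : Fin n →₀ ℕ), (∀ γ, γ.degree = i → β + γ ∈ I) →
        codeMap wt I (MvPolynomial.monomial β 1 * P i) = bits (C.getD i 0 <<< code wt β) := by
  classical
  have h : ∀ i, ∃ P : MvPolynomial (Fin n) (ZMod 2), P.IsHomogeneous i ∧ (i = 0 → P = 1) ∧
      ∀ (I : Set (Fin n →₀ ℕ)) (β : Fin n →₀ ℕ), (∀ γ, γ.degree = i → β + γ ∈ I) →
        codeMap wt I (MvPolynomial.monomial β 1 * P) = bits (C.getD i 0 <<< code wt β) := by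
    intro i
    rcases Nat.eq_zero_or_pos i with rfl | hi
    · refine ⟨1, MvPolynomial.isHomogeneous_one _ _, fun _ => rfl, fun I β hI => ?_⟩
      have := hI 0 (by simp)
      rw [add_zero] at this
      rw [mul_one, codeMap_monomial, if_pos this, hC0, ← sum_range_single_eq_bits]
      rw [Finset.sum_eq_single 0]
      · simp
      · intro i hi hi'
        rw [if_neg]
        simpa [Nat.testBit_one_eq_true_iff_self_eq_zero] using hi'
      · simp
    · obtain ⟨P, h1, h2⟩ := exists_isHomogeneous_codeMap (n := n) wt (i := i) (C := C.getD i 0)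
        (fun k hk => by simpa using hC.isCode i k hk)
      exact ⟨P, h1, fun h => by omega, h2⟩
  choose P h1 h2 h3 using h
  refine ⟨P, fun γ => (∑ i ∈ Finset.range (d + 1), P i).coeff γ.1, h1, ?_, h3⟩
  have hcoeff : ∀ γ : Fin n →₀ ℕ, (∑ i ∈ Finset.range (d + 1), P i).coeff γ =
      if γ.degree ≤ d then (P γ.degree).coeff γ else 0 := by
    intro γ
    rw [MvPolynomial.coeff_sum]
    have : ∀ i, (P i).coeff γ = if i = γ.degree then (P γ.degree).coeff γ else 0 := by
      intro i
      split_ifs with h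
      · rw [h]
      · exact (h1 i).coeff_eq_zero (fun h' => h h'.symm)
    rw [Finset.sum_congr rfl fun i _ => this i, Finset.sum_ite_eq']
    simp
  ext γ
  rw [MvPolynomial.coeff_coe]
  by_cases h0 : γ = 0
  · subst h0
    rw [MvPowerSeries.coeff_zero_eq_constantCoeff, constantCoeff_unitSeries, hcoeff]
    simp [h2]
  · by_cases hd : γ.degree ≤ d
    · exact coeff_unitSeries_coeffIdx _ ⟨γ, h0, hd⟩
    · rw [coeff_unitSeries_of_lt _ (not_le.1 hd), hcoeff, if_neg hd]

end Witness

end TaylorVariety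

/-! ### Rank of the denominator system -/

namespace TaylorVariety

variable {n d e m : ℕ}

/-- The weights `W, W + 1, W + B, W + B ^ 2, …`. -/
noncomputable def weight (W B : ℕ) (i : ℕ) : ℕ :=
  -- The base used is B = m + 1. With W = B^(n−1) the weights separate all monomials of degree at
  -- most m; with W = 0 they separate monomials of one fixed degree. Collisions could weaken the
  -- rank bound but not invalidate it.
  Nat.rec W (fun k _ => Nat.add W (Nat.pow B k)) i

/-- Pseudorandom binary digits. -/
def randomBits (s : ℕ) : ℕ := Nat.shiftRight (Nat.pow 3 (Nat.add 30000 s)) 100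

/-- The rank over the field with two elements of the linear system for the denominator, for
denominator `1` and a pseudorandom numerator. -/
noncomputable def lowerRank (n d e m W s : ℕ) : ℕ :=
  strict (fun S => (eliminate (rowsFrom d m (comps (weight W (Nat.succ m)) S d n)
    (codeTable (weight W (Nat.succ m)) e n).tail 1) []).length) (randomBits s)

/-- The encoding is a linear function of the coefficients in degrees d+1,…,m, so the rank of the
encoded rows cannot exceed that of the original family. -/
theorem exists_lowerRank_le_finrank (n d e m W s : ℕ) :
    ∃ p : CoeffIdx n d → ZMod 2, lowerRank n d e m W s ≤ Module.finrank (ZMod 2)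
      (Submodule.span (ZMod 2) (Set.range fun (β : CoeffIdx n e) (γ : Window n d m) =>
        MvPowerSeries.coeff γ.1 (MvPowerSeries.monomial β.1 1 * unitSeries p))) := by
  classical
  rw [lowerRank, strict_eq]
  generalize randomBits s = S
  generalize weight W (Nat.succ m) = wt
  obtain ⟨hC, hlen⟩ := areMasks_comps (n := n) (wt := wt) S d
  obtain ⟨P, p, hP, hp, hcode⟩ := exists_components (d := d) wt hC rfl
  refine ⟨p, ?_⟩
  have : Finite {γ : Fin n →₀ ℕ | d < γ.degree ∧ γ.degree ≤ m} :=
    inferInstanceAs (Finite (Window n d m))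
  obtain ⟨Λ, hΛ⟩ := exists_linearMap_codeMap wt {γ : Fin n →₀ ℕ | d < γ.degree ∧ γ.degree ≤ m}
  have hT := areCodes_codeTable (n := n) (wt := wt) e le_rfl
  have hT' : AreCodes n wt 1 (codeTable wt e n).tail ∧ (codeTable wt e n).tail.length = e := by
    revert hT
    cases codeTable wt e n with
    | nil => simp
    | cons L T => exact fun h => ⟨h.1.2, by simpa using h.2⟩
  refine length_eliminate_le_finrank_of_rows _ Λ fun r hr => ?_
  obtain ⟨β, h1, h2, rfl⟩ := mem_rowsFrom hT'.1 hr
  rw [hT'.2] at h2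
  have hβ : β ≠ 0 ∧ β.degree ≤ e := by
    refine ⟨?_, by omega⟩
    rintro rfl
    simp at h1
  refine ⟨⟨β, hβ⟩, _, rfl, ?_⟩
  have hR := hΛ (MvPolynomial.monomial β 1 * ∑ i ∈ Finset.range (d + 1), P i)
  have hcoe : (fun γ : {γ : Fin n →₀ ℕ | d < γ.degree ∧ γ.degree ≤ m} =>
      MvPolynomial.coeff γ.1 (MvPolynomial.monomial β 1 * ∑ i ∈ Finset.range (d + 1), P i)) =
      fun γ => MvPowerSeries.coeff γ.1 (MvPowerSeries.monomial β 1 * unitSeries p) := by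
    funext γ
    rw [hp, ← MvPolynomial.coe_monomial, ← MvPolynomial.coe_mul, MvPolynomial.coeff_coe]
  rw [hcoe] at hR
  refine hR.symm.trans ?_
  rw [Finset.mul_sum, map_sum, bits_windowXor, hlen]
  refine Finset.sum_congr rfl fun i _ => ?_
  rw [zero_add]
  split_ifs with hi
  · refine hcode i _ β fun γ hγ => ?_
    rw [Set.mem_ofPred_eq, map_add, hγ]
    omega
  · refine codeMap_monomial_mul_eq_zero wt _ (hP i) β fun γ hγ => ?_
    rw [Set.mem_ofPred_eq, map_add, hγ]
    omega

end TaylorVariety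

/-! ### The finite check of the lower bounds -/

namespace TaylorVariety

/-- The conjunction of the values of `f` below `k`. -/
noncomputable def allBelow (f : ℕ → Bool) (k : ℕ) : Bool :=
  Nat.rec true (fun i ih => Bool.and (f i) ih) k

theorem of_allBelow {f : ℕ → Bool} {k : ℕ} (h : allBelow f k = true) {i : ℕ} (hi : i < k) :
    f i = true := by
  induction k with
  | zero => omega
  | succ k ih =>
    have h' : (f k && allBelow f k) = true := h
    rw [Bool.and_eq_true] at h'
    rcases Nat.lt_succ_iff_lt_or_eq.1 hi with hi | rfl
    · exact ih h'.2 hi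
    · exact h'.1

/-- The disjunction of the values of `f` below `k`. -/
noncomputable def anyBelow (f : ℕ → Bool) (k : ℕ) : Bool :=
  Nat.rec false (fun i ih => Bool.or (f i) ih) k

theorem exists_of_anyBelow {f : ℕ → Bool} {k : ℕ} (h : anyBelow f k = true) :
    ∃ i, f i = true := by
  induction k with
  | zero => cases h
  | succ k ih =>
    have h' : (f k || anyBelow f k) = true := h
    rw [Bool.or_eq_true] at h'
    rcases h' with h' | h'
    · exact ⟨k, h'⟩
    · exact ih h'

/-- The dimension of a Taylor variety according to the table. -/
def claimedDim (n d e m : ℕ) : ℕ :=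
  match table.find? (fun r => r.n == n && r.d == d && r.e == e && r.m == m) with
  | some r => r.dim
  | none => expectedDim n d e m

/-- Some pseudorandom numerator leads to a rank as large as required for the claimed dimension. -/
noncomputable def lowerCheck (n d e m : ℕ) : Bool :=
  anyBelow (fun s => Nat.ble (Nat.succ (claimedDim n d e m)) (Nat.add ((d + n).choose n)
    -- If d + 1 = m, only products of degree m matter and W = 0 suffices to separate them.
    -- `anyBelow` examines large indices first, so `Nat.sub 7 s` tries the seeds 0,…,7 in increasing
    -- order.
    (lowerRank n d e m (if d + 1 = m then 0 else (m + 1) ^ (n - 1)) (Nat.sub 7 s)))) 8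

/-- The conjunction of `lowerCheck` for all degrees of the denominator up to `d`. -/
noncomputable def lowerCheckAll (n d m : ℕ) : Bool :=
  allBelow (fun e => lowerCheck n d e m) (Nat.succ d)

/-- The computational core of all lower bounds. The cases e > d are reduced to these by the exchange
of numerator and denominator, and m ≤ d is settled without computation. -/
theorem lowerCheckAll_eq_true {n d m : ℕ} (hn : 1 ≤ n) (hn5 : n ≤ 5) (hm : m ≤ 12 - n)
    (hdm : d < m) : lowerCheckAll n d m = true := by
  interval_cases n <;> norm_num only at hm <;> interval_cases m <;> interval_cases d <;>
    decide +kernel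

end TaylorVariety

/-! ### Koszul syzygies: upper bounds for m = d + 1 -/

namespace TaylorVariety

open MvPowerSeries (homogeneousComponent)

theorem bits_xor_eq_sub (a b : ℕ) : bits (a ^^^ b) = bits a - bits b := by
  rw [bits_xor, sub_eq_add_neg]
  congr 1
  funext i
  rw [Pi.neg_apply, ZMod.neg_eq_self_mod_two]

section HomogeneousComponents

variable {σ R S : Type} [CommRing R] [CommRing S]

theorem map_homogeneousComponent (φ : R →+* S) (i : ℕ) (f : MvPowerSeries σ R) :
    MvPowerSeries.map φ (homogeneousComponent i f) = homogeneousComponent i (MvPowerSeries.map φ f) := by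
  ext γ
  rw [MvPowerSeries.coeff_map, MvPowerSeries.coeff_homogeneousComponent,
    MvPowerSeries.coeff_homogeneousComponent, MvPowerSeries.coeff_map]
  split_ifs <;> simp

theorem coeff_homogeneous_mul {f g : MvPowerSeries σ R} {a b : ℕ} (hf : f.IsHomogeneous a)
    {γ : σ →₀ ℕ} (hγ : γ.degree = a + b) :
    MvPowerSeries.coeff γ (f * g) = MvPowerSeries.coeff γ (f * homogeneousComponent b g) := by
  classical
  rw [MvPowerSeries.coeff_mul, MvPowerSeries.coeff_mul]
  refine Finset.sum_congr rfl fun p hp => ?_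
  rw [MvPowerSeries.coeff_homogeneousComponent]
  by_cases hpa : p.1.degree = a
  · have := congrArg Finsupp.degree (Finset.HasAntidiagonal.mem_antidiagonal.1 hp)
    rw [map_add] at this
    rw [if_pos (by omega)]
  · rw [hf.coeff_eq_zero hpa, zero_mul, zero_mul]

theorem isHomogeneous_monomial (β : σ →₀ ℕ) (r : R) :
    (MvPowerSeries.monomial β r).IsHomogeneous β.degree := by
  classical
  rw [MvPowerSeries.isHomogeneous_iff_eq_homogeneousComponent]
  ext γ
  rw [MvPowerSeries.coeff_homogeneousComponent, MvPowerSeries.coeff_monomial]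
  split_ifs with h1 h2 <;> simp_all

theorem mvPolynomial_coe_sub (P Q : MvPolynomial σ R) :
    ((P - Q : MvPolynomial σ R) : MvPowerSeries σ R) = P - Q :=
  map_sub (MvPolynomial.coeToMvPowerSeries.ringHom (σ := σ) (R := R)) P Q

theorem homogeneousComponent_sum_coe {P : ℕ → MvPolynomial σ R} (hP : ∀ i, (P i).IsHomogeneous i)
    {d i : ℕ} (hi : i ≤ d) :
    homogeneousComponent i ((∑ k ∈ Finset.range (d + 1), P k : MvPolynomial σ R) :
      MvPowerSeries σ R) = (P i : MvPowerSeries σ R) := by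
  ext γ
  rw [MvPowerSeries.coeff_homogeneousComponent, MvPolynomial.coeff_coe, MvPolynomial.coeff_coe,
    MvPolynomial.coeff_sum]
  split_ifs with h
  · refine Finset.sum_eq_single i (fun k _ hk => (hP k).coeff_eq_zero ?_) ?_
    · omega
    · intro h'
      exact absurd (Finset.mem_range.2 (by omega)) h'
  · exact ((hP i).coeff_eq_zero h).symm

variable {n e : ℕ}

/-- A power series with terms in degrees `1, …, e` only is determined by the coefficients in these
degrees. -/
theorem dirSeries_coeff {f : MvPowerSeries (Fin n) R} (h0 : MvPowerSeries.coeff 0 f = 0)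
    (hf : ∀ γ : Fin n →₀ ℕ, e < γ.degree → MvPowerSeries.coeff γ f = 0) :
    dirSeries (fun γ : CoeffIdx n e => MvPowerSeries.coeff γ.1 f) = f := by
  ext γ
  rw [coeff_dirSeries]
  split_ifs with h
  · rfl
  · rcases not_and_or.1 h with h | h
    · rw [not_not.1 h, h0]
    · rw [hf γ (not_le.1 h)]

end HomogeneousComponents

section Koszul

variable {n d e m : ℕ} {R : Type} [CommRing R]

/-- The polynomial `x ^ β (c_{m - k} - c_{m - j})`, in terms of the homogeneous components of the
power series `c`. -/
noncomputable def koszulSeries (m : ℕ) (c : MvPowerSeries (Fin n) R) (j k : ℕ) (β : Fin n →₀ ℕ) :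
    MvPowerSeries (Fin n) R :=
  MvPowerSeries.monomial β 1 * (homogeneousComponent (m - k) c - homogeneousComponent (m - j) c)

theorem isHomogeneous_monomial_mul (c : MvPowerSeries (Fin n) R) (β : Fin n →₀ ℕ) (i : ℕ) :
    (MvPowerSeries.monomial β 1 * homogeneousComponent i c).IsHomogeneous (β.degree + i) :=
  MvPowerSeries.IsHomogeneous.mul (isHomogeneous_monomial β 1)
    (MvPowerSeries.isHomogeneous_homogeneousComponent c i)

/-- The multiplier has the terms x^β·c_{m−k} of degree j and −x^β·c_{m−j} of degree k. In degree m
they meet c_{m−j} and c_{m−k} respectively, and the two products cancel. -/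
theorem coeff_koszulSeries_mul (c : MvPowerSeries (Fin n) R) {j k : ℕ} {β : Fin n →₀ ℕ}
    (hjm : j ≤ m) (hkm : k ≤ m) (hβ : m + β.degree = j + k) {γ : Fin n →₀ ℕ} (hγ : γ.degree = m) :
    MvPowerSeries.coeff γ (koszulSeries m c j k β * c) = 0 := by
  rw [koszulSeries, mul_sub, sub_mul, map_sub,
    coeff_homogeneous_mul (isHomogeneous_monomial_mul c β (m - k)) (b := m - j) (by omega),
    coeff_homogeneous_mul (isHomogeneous_monomial_mul c β (m - j)) (b := m - k) (by omega),
    mul_right_comm, sub_self]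

theorem dirSeries_koszulSeries (c : MvPowerSeries (Fin n) R) {j k : ℕ} {β : Fin n →₀ ℕ}
    (hj : 1 ≤ j) (hjk : j < k) (hke : k ≤ e) (hem : e < m) (hβ : m + β.degree = j + k) :
    dirSeries (fun γ : CoeffIdx n e => MvPowerSeries.coeff γ.1 (koszulSeries m c j k β)) =
      koszulSeries m c j k β := by
  have h : ∀ γ : Fin n →₀ ℕ, γ.degree ≠ j → γ.degree ≠ k →
      MvPowerSeries.coeff γ (koszulSeries m c j k β) = 0 := by
    intro γ h1 h2
    rw [koszulSeries, mul_sub, map_sub,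
      MvPowerSeries.IsHomogeneous.coeff_eq_zero (isHomogeneous_monomial_mul c β (m - k)) (by omega),
      MvPowerSeries.IsHomogeneous.coeff_eq_zero (isHomogeneous_monomial_mul c β (m - j)) (by omega),
      sub_zero]
  refine dirSeries_coeff (h 0 ?_ ?_) fun γ hγ => h γ ?_ ?_
  · rw [map_zero]; omega
  · rw [map_zero]; omega
  · omega
  · omega

theorem map_koszulSeries {S : Type} [CommRing S] (φ : R →+* S) (c : MvPowerSeries (Fin n) R)
    (j k : ℕ) (β : Fin n →₀ ℕ) :
    MvPowerSeries.map φ (koszulSeries m c j k β) = koszulSeries m (MvPowerSeries.map φ c) j k β := by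
  rw [koszulSeries, koszulSeries, map_mul, map_sub, map_homogeneousComponent,
    map_homogeneousComponent, MvPowerSeries.map_monomial, map_one]

/-- The binary vectors of the polynomials `koszulSeries`. -/
noncomputable def koszulRows (e m : ℕ) (C : List ℕ) (T : List (List ℕ)) : List ℕ :=
  (List.range (e + 1)).flatMap fun k => (List.range k).flatMap fun j =>
    if 1 ≤ j ∧ m ≤ j + k then
      strict (fun S => shiftAll S (T.getD (j + k - m) []) [])
        (Nat.xor (C.getD (m - k) 0) (C.getD (m - j) 0))
    else []

/-- The rank over the field with two elements of the polynomials `koszulSeries`, for the expansion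
of a pseudorandom polynomial. -/
noncomputable def koszulRank (n e m W : ℕ) : ℕ :=
  strict (fun S => (eliminate (koszulRows e m (comps (weight W (Nat.succ m)) S (Nat.pred m) n)
    (codeTable (weight W (Nat.succ m)) e n)) []).length) (randomBits 0)

/-- For d = m − 1 a direction is constrained in degree m only, which is where Koszul syzygies
cancel. Their rank after specialization bounds the number of independent directions from below. -/
theorem trdeg_add_koszulRank_le (hem : e < m) (W : ℕ) :
    Algebra.trdeg ℂ (coneAlgebra n (m - 1) e m) + koszulRank n e m W
      ≤ (Nat.card (CoeffIdx n (m - 1)) + Nat.card (CoeffIdx n e) + 1 : ℕ) := by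
  classical
  rw [koszulRank, strict_eq]
  generalize randomBits 0 = S
  generalize weight W (Nat.succ m) = wt
  obtain ⟨hC, -⟩ := areMasks_comps (n := n) (wt := wt) S (m - 1)
  obtain ⟨P, p, hP, hp, hcode⟩ := exists_components (d := m - 1) wt hC rfl
  have hT := areCodes_codeTable (n := n) (wt := wt) e le_rfl
  -- All pairs of degrees together with a monomial serve as a finite index set; indices violating
  -- the degree condition are given the zero direction.
  let good : Fin (e + 1) × Fin (e + 1) × Exponent n e → Prop := fun t =>
    1 ≤ t.1.1 ∧ t.1.1 < t.2.1.1 ∧ m + t.2.2.1.degree = t.1.1 + t.2.1.1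
  let u : Fin (e + 1) × Fin (e + 1) × Exponent n e → CoeffIdx n e → ParamRing n (m - 1) e :=
    fun t γ => if good t then MvPowerSeries.coeff γ.1
      (koszulSeries m (integralSeries n (m - 1) e) t.1.1 t.2.1.1 t.2.2.1) else 0
  refine trdeg_add_le_of_finrank p u (fun t γ h1 h2 => ?_) ?_
  · by_cases ht : good t
    · have hu : u t = fun γ => MvPowerSeries.coeff γ.1
          (koszulSeries m (integralSeries n (m - 1) e) t.1.1 t.2.1.1 t.2.2.1) := by
        funext γ
        exact if_pos ht
      have hk : t.2.1.1 ≤ e := Nat.lt_succ_iff.1 t.2.1.2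
      rw [hu, dirSeries_koszulSeries _ ht.1 ht.2.1 hk hem ht.2.2]
      exact coeff_koszulSeries_mul _ (by have := ht.2.1; omega) (by omega) ht.2.2 (by omega)
    · have hu : u t = 0 := by
        funext γ
        exact if_neg ht
      have : dirSeries (0 : CoeffIdx n e → ParamRing n (m - 1) e) = 0 := by
        ext γ
        rw [coeff_dirSeries]
        simp
      rw [hu, this, zero_mul, map_zero]
  · have : Finite {γ : Fin n →₀ ℕ | γ ≠ 0 ∧ γ.degree ≤ e} :=
      inferInstanceAs (Finite (CoeffIdx n e))
    obtain ⟨Λ, hΛ⟩ := exists_linearMap_codeMap wt {γ : Fin n →₀ ℕ | γ ≠ 0 ∧ γ.degree ≤ e}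
    refine length_eliminate_le_finrank_of_rows _ Λ fun r hr => ?_
    rw [koszulRows, List.mem_flatMap] at hr
    obtain ⟨k, hk, hr⟩ := hr
    rw [List.mem_flatMap] at hr
    obtain ⟨j, hj, hr⟩ := hr
    rw [List.mem_range] at hk hj
    split_ifs at hr with hjk
    swap
    · simp at hr
    rw [strict_eq] at hr
    rcases mem_shiftAll hr with hr | ⟨a, ha, rfl⟩
    · simp at hr
    obtain ⟨β, hβ, rfl⟩ := hT.1.isCode _ _ ha
    have ht : good (⟨j, by omega⟩, ⟨k, hk⟩, ⟨β, by omega⟩) := ⟨hjk.1, hj, by simp only; omega⟩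
    refine ⟨(⟨j, by omega⟩, ⟨k, hk⟩, ⟨β, by omega⟩), _, rfl, ?_⟩
    have hR := hΛ (MvPolynomial.monomial β 1 * (P (m - k) - P (m - j)))
    have hcoe : (fun γ : {γ : Fin n →₀ ℕ | γ ≠ 0 ∧ γ.degree ≤ e} =>
        MvPolynomial.coeff γ.1 (MvPolynomial.monomial β 1 * (P (m - k) - P (m - j)))) =
        fun γ => specialize (e := e) p (u (⟨j, by omega⟩, ⟨k, hk⟩, ⟨β, by omega⟩) γ) := by
      funext γ
      have hu : u (⟨j, by omega⟩, ⟨k, hk⟩, ⟨β, by omega⟩) γ = MvPowerSeries.coeff γ.1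
          (koszulSeries m (integralSeries n (m - 1) e) j k β) := if_pos ht
      rw [hu, ← MvPowerSeries.coeff_map, map_koszulSeries, map_specialize_integralSeries, hp,
        koszulSeries, homogeneousComponent_sum_coe hP (by omega),
        homogeneousComponent_sum_coe hP (by omega), ← MvPolynomial.coeff_coe,
        MvPolynomial.coe_mul, MvPolynomial.coe_monomial, mvPolynomial_coe_sub]
    rw [hcoe] at hR
    refine hR.symm.trans ?_
    rw [mul_sub, map_sub, hcode, hcode, ← bits_xor_eq_sub, ← Nat.shiftLeft_xor_distrib]
    · rfl
    · intro γ hγ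
      have h := map_add Finsupp.degree β γ
      refine ⟨fun h0 => ?_, by omega⟩
      rw [h0, map_zero] at h
      omega
    · intro γ hγ
      have h := map_add Finsupp.degree β γ
      refine ⟨fun h0 => ?_, by omega⟩
      rw [h0, map_zero] at h
      omega

end Koszul

end TaylorVariety

/-! ### The minor relation for (6, 6, 8) and the case m ≤ d -/

namespace TaylorVariety

open MvPowerSeries (homogeneousComponent)

section Minors

variable {n : ℕ} {R S : Type} [CommRing R] [CommRing S]

/-- The alternating sum of the `2 × 2` minors of the matrix with rows `c₁, c₂, c₃` and
`c₂, c₃, c₄`, where `c₁, c₂, …` are the homogeneous components of a power series. -/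
noncomputable def minorSeries (c : MvPowerSeries (Fin n) R) : MvPowerSeries (Fin n) R :=
  (homogeneousComponent 2 c * homogeneousComponent 2 c
      - homogeneousComponent 1 c * homogeneousComponent 3 c)
    - (homogeneousComponent 2 c * homogeneousComponent 3 c
      - homogeneousComponent 1 c * homogeneousComponent 4 c)
    + (homogeneousComponent 3 c * homogeneousComponent 3 c
      - homogeneousComponent 2 c * homogeneousComponent 4 c)

theorem isHomogeneous_component_mul (c : MvPowerSeries (Fin n) R) (i j : ℕ) :
    MvPowerSeries.IsHomogeneous (homogeneousComponent i c * homogeneousComponent j c) (i + j) :=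
  MvPowerSeries.IsHomogeneous.mul (MvPowerSeries.isHomogeneous_homogeneousComponent c i)
    (MvPowerSeries.isHomogeneous_homogeneousComponent c j)

theorem coeff_component_mul_mul (c : MvPowerSeries (Fin n) R) (i j k : ℕ) {γ : Fin n →₀ ℕ}
    (hγ : γ.degree = i + j + k) :
    MvPowerSeries.coeff γ (homogeneousComponent i c * homogeneousComponent j c * c) =
      MvPowerSeries.coeff γ
        (homogeneousComponent i c * homogeneousComponent j c * homogeneousComponent k c) :=
  coeff_homogeneous_mul (isHomogeneous_component_mul c i j) hγ

/-- Up to sign, the part of the product in degree 7 or 8 is a 3 × 3 determinant with rows c₁, c₂, c₃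
and c₂, c₃, c₄ in which the first or the second row, respectively, is repeated. -/
theorem coeff_minorSeries_mul (c : MvPowerSeries (Fin n) R) {γ : Fin n →₀ ℕ}
    (h1 : 6 < γ.degree) (h2 : γ.degree ≤ 8) : MvPowerSeries.coeff γ (minorSeries c * c) = 0 := by
  obtain ⟨k, hk, hγ⟩ : ∃ k, k < 2 ∧ γ.degree = 7 + k := ⟨γ.degree - 7, by omega, by omega⟩
  rw [minorSeries, add_mul, sub_mul, sub_mul, sub_mul, sub_mul]
  simp only [map_add, map_sub]
  rw [coeff_component_mul_mul c 2 2 (3 + k) (by omega), coeff_component_mul_mul c 1 3 (3 + k) (by omega),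
    coeff_component_mul_mul c 2 3 (2 + k) (by omega), coeff_component_mul_mul c 1 4 (2 + k) (by omega),
    coeff_component_mul_mul c 3 3 (1 + k) (by omega), coeff_component_mul_mul c 2 4 (1 + k) (by omega)]
  simp only [← map_add, ← map_sub]
  interval_cases k
  · norm_num only
    ring_nf
    exact map_zero _
  · norm_num only
    ring_nf
    exact map_zero _

theorem dirSeries_minorSeries (c : MvPowerSeries (Fin n) R) :
    dirSeries (fun γ : CoeffIdx n 6 => MvPowerSeries.coeff γ.1 (minorSeries c)) =
      minorSeries c := by
  have h : ∀ γ : Fin n →₀ ℕ, γ.degree < 4 ∨ 6 < γ.degree →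
      MvPowerSeries.coeff γ (minorSeries c) = 0 := by
    intro γ hγ
    have h' : ∀ i j, 4 ≤ i + j → i + j ≤ 6 → MvPowerSeries.coeff γ
        (homogeneousComponent i c * homogeneousComponent j c) = 0 := fun i j h1 h2 =>
      MvPowerSeries.IsHomogeneous.coeff_eq_zero (isHomogeneous_component_mul c i j) (by omega)
    rw [minorSeries]
    simp only [map_add, map_sub]
    rw [h' 2 2 (by omega) (by omega), h' 1 3 (by omega) (by omega), h' 2 3 (by omega) (by omega),
      h' 1 4 (by omega) (by omega), h' 3 3 (by omega) (by omega), h' 2 4 (by omega) (by omega)]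
    simp
  exact dirSeries_coeff (h 0 (by simp)) fun γ hγ => h γ (Or.inr hγ)

theorem map_minorSeries (φ : R →+* S) (c : MvPowerSeries (Fin n) R) :
    MvPowerSeries.map φ (minorSeries c) = minorSeries (MvPowerSeries.map φ c) := by
  simp only [minorSeries, map_add, map_sub, map_mul, map_homogeneousComponent]

/-- The minor relation is one direction unchanged in both constrained degrees; it only remains to
see that it is nonzero, by specializing. -/
theorem trdeg_coneAlgebra_six_six_eight_add_one_le (hn : 0 < n) :
    Algebra.trdeg ℂ (coneAlgebra n 6 6 8) + (1 : ℕ)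
      ≤ (Nat.card (CoeffIdx n 6) + Nat.card (CoeffIdx n 6) + 1 : ℕ) := by
  classical
  let δ : ℕ → Fin n →₀ ℕ := fun k => Finsupp.single ⟨0, hn⟩ k
  have hδ : ∀ k, (δ k).degree = k := fun k => by simp [δ]
  -- The numerator is 1 + x₀². Of the components c₁,…,c₄ only c₂ = x₀² survives, and the combination
  -- of minors becomes c₂².
  let p : CoeffIdx n 6 → ZMod 2 := fun γ => if γ.1 = δ 2 then 1 else 0
  have hcomp : ∀ i, 1 ≤ i → homogeneousComponent i (unitSeries p) =
      if i = 2 then MvPowerSeries.monomial (δ 2) 1 else 0 := by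
    intro i hi
    ext γ
    rw [MvPowerSeries.coeff_homogeneousComponent, coeff_unitSeries]
    have h0 : ∀ γ : Fin n →₀ ℕ, γ.degree = i → γ ≠ 0 := by
      rintro γ hγ rfl
      rw [map_zero] at hγ
      omega
    by_cases hi2 : i = 2
    · subst hi2
      rw [if_pos rfl, MvPowerSeries.coeff_monomial]
      by_cases hγ : γ.degree = 2
      · rw [if_pos hγ, dif_pos ⟨h0 γ hγ, by omega⟩]
      · rw [if_neg hγ, if_neg]
        rintro rfl
        exact hγ (hδ 2)
    · rw [if_neg hi2, map_zero]
      split_ifs with h1 h2 h3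
      · refine if_neg ?_
        rintro rfl
        rw [hδ] at h1
        exact hi2 h1.symm
      · exact absurd h3 (h0 γ h1)
      · rfl
      · rfl
  have hminor : minorSeries (unitSeries p) = MvPowerSeries.monomial (δ 2 + δ 2) 1 := by
    rw [minorSeries, hcomp 1 le_rfl, hcomp 2 (by omega), hcomp 3 (by omega), hcomp 4 (by omega)]
    simp [MvPowerSeries.monomial_mul_monomial]
  let u : Unit → CoeffIdx n 6 → ParamRing n 6 6 := fun _ γ =>
    MvPowerSeries.coeff γ.1 (minorSeries (integralSeries n 6 6))
  refine trdeg_add_le_of_finrank p u (fun t γ h1 h2 => ?_) ?_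
  · rw [dirSeries_minorSeries]
    exact coeff_minorSeries_mul _ h1 h2
  · rw [Set.range_unique, Nat.one_le_iff_ne_zero, Ne, finrank_span_singleton]
    · exact one_ne_zero
    · intro h
      have hdeg : (δ 2 + δ 2).degree = 4 := by rw [map_add, hδ]
      have hne : δ 2 + δ 2 ≠ 0 := by
        intro h0
        rw [h0, map_zero] at hdeg
        omega
      have := congrFun h ⟨δ 2 + δ 2, hne, by omega⟩
      simp only [u] at this
      rw [← MvPowerSeries.coeff_map, map_minorSeries, map_specialize_integralSeries, hminor,
        MvPowerSeries.coeff_monomial_same] at this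
      exact one_ne_zero this

end Minors

section FullDimension

variable {n d e m : ℕ}

/-- Already with denominator 1, every vector with nonzero constant coordinate is a scaled Taylor
polynomial when m ≤ d. A relation therefore becomes zero after multiplication by that coordinate,
hence is zero. -/
theorem algebraicIndependent_coneCoord (hmd : m ≤ d) :
    AlgebraicIndependent ℂ (coneCoord n d e m) := by
  rw [algebraicIndependent_iff]
  intro F hF
  rw [aeval_coneCoord_eq_zero_iff] at hF
  let o : Exponent n m := ⟨0, by simp⟩
  have h : MvPolynomial.X o * F = 0 := by
    refine MvPolynomial.funext fun x => ?_
    rw [map_mul, MvPolynomial.eval_X, map_zero]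
    by_cases hx : x o = 0
    · rw [hx, zero_mul]
    · have := hF (x o) (fun γ => if h : γ.1.degree ≤ m then (x o)⁻¹ * x ⟨γ.1, h⟩ else 0) 0
      have hfun : (fun γ : Exponent n m => x o * MvPowerSeries.coeff γ.1
          (quotSeries (fun γ : CoeffIdx n d => if h : γ.1.degree ≤ m then (x o)⁻¹ * x ⟨γ.1, h⟩ else 0)
            (0 : CoeffIdx n e → ℂ))) = x := by
        funext γ
        rw [quotSeries_zero_right]
        by_cases h0 : γ.1 = 0
        · have : γ = o := Subtype.ext h0
          rw [this]
          simp [o]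
        · have := coeff_unitSeries_coeffIdx (fun γ : CoeffIdx n d =>
            if h : γ.1.degree ≤ m then (x o)⁻¹ * x ⟨γ.1, h⟩ else 0) ⟨γ.1, h0, γ.2.trans hmd⟩
          rw [this, dif_pos γ.2, mul_inv_cancel_left₀ hx]
      rw [hfun] at this
      rw [this, mul_zero]
  exact (mul_eq_zero.1 h).resolve_left (MvPolynomial.X_ne_zero _)

theorem choose_le_trdeg_of_le (hmd : m ≤ d) :
    (((m + n).choose n : ℕ) : Cardinal) ≤ Algebra.trdeg ℂ (coneAlgebra n d e m) := by
  let x : Exponent n m → coneAlgebra n d e m := fun γ =>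
    ⟨coneCoord n d e m γ, Algebra.subset_adjoin ⟨γ, rfl⟩⟩
  have hx : AlgebraicIndependent ℂ x :=
    ((coneAlgebra n d e m).val.algebraicIndependent_iff Subtype.val_injective).1
      (algebraicIndependent_coneCoord hmd)
  have h := hx.cardinalMk_le_trdeg
  rwa [← Nat.cast_card, card_exponent] at h

end FullDimension

end TaylorVariety

/-! ### Comparison with the table -/

namespace TaylorVariety

theorem table_bounds : ∀ r ∈ table, 1 ≤ r.n ∧ r.n ≤ 5 ∧ r.d < r.m ∧ r.e < r.m ∧ r.m ≤ 12 - r.n := by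
  decide +kernel

theorem table_numParameters : ∀ r ∈ table, numParameters r.n r.d r.e = r.params := by
  decide +kernel

theorem table_ambientDim : ∀ r ∈ table, ambientDim r.n r.m = r.ambient := by
  decide +kernel

theorem table_dim_lt : ∀ r ∈ table, r.dim < min r.params r.ambient := by
  decide +kernel

theorem table_swap : ∀ r ∈ table, ∃ r' ∈ table,
    r'.n = r.n ∧ r'.d = r.e ∧ r'.e = r.d ∧ r'.m = r.m ∧ r'.dim = r.dim := by
  decide +kernel

theorem table_dim_unique : ∀ r ∈ table, ∀ r' ∈ table,
    r'.n = r.n → r'.d = r.d → r'.e = r.e → r'.m = r.m → r'.dim = r.dim := by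
  decide +kernel

/-- Decides which upper bound applies once e ≤ d: Koszul syzygies when d + 1 = m, and the minor
relation for the single remaining row. -/
theorem table_order : ∀ r ∈ table, r.e ≤ r.d →
    r.d + 1 = r.m ∨ (r.n = 4 ∧ r.d = 6 ∧ r.e = 6 ∧ r.m = 8 ∧ r.dim = 417) := by
  decide +kernel

/-- The rank of the polynomials `koszulSeries` is as large as required by a row of the table. -/
noncomputable def upperCheck (r : Row) : Bool :=
  Nat.ble r.params (Nat.add r.dim (koszulRank r.n r.e r.m ((r.m + 1) ^ (r.n - 1))))

/-- The independent Koszul directions account for the whole gap between the number of parameters and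
the dimension in the table. -/
theorem upperCheck_table :
    (table.all fun r => !(Nat.ble r.e r.d && Nat.beq (r.d + 1) r.m) || upperCheck r) = true := by
  decide +kernel

/-- A row of the table with given parameters. -/
def InTable (n d e m : ℕ) : Prop := ∃ r ∈ table, r.n = n ∧ r.d = d ∧ r.e = e ∧ r.m = m

theorem claimedDim_of_not_inTable {n d e m : ℕ} (h : ¬ InTable n d e m) :
    claimedDim n d e m = expectedDim n d e m := by
  have : table.find? (fun r => r.n == n && r.d == d && r.e == e && r.m == m) = none := by
    rw [List.find?_eq_none]
    intro r hr hc
    simp only [Bool.and_eq_true, beq_iff_eq] at hc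
    exact h ⟨r, hr, hc.1.1.1, hc.1.1.2, hc.1.2, hc.2⟩
  rw [claimedDim, this]

theorem claimedDim_of_mem {r : Row} (hr : r ∈ table) : claimedDim r.n r.d r.e r.m = r.dim := by
  rw [claimedDim]
  cases hf : table.find? (fun r' => r'.n == r.n && r'.d == r.d && r'.e == r.e && r'.m == r.m) with
  | none =>
    rw [List.find?_eq_none] at hf
    exact absurd (hf r hr) (by simp)
  | some r' =>
    have h1 := List.mem_of_find?_eq_some hf
    have h2 := List.find?_some hf
    simp only [Bool.and_eq_true, beq_iff_eq] at h2
    exact table_dim_unique r hr r' h1 h2.1.1.1 h2.1.1.2 h2.1.2 h2.2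

theorem InTable.swap {n d e m : ℕ} (h : InTable n d e m) : InTable n e d m := by
  obtain ⟨r, hr, rfl, rfl, rfl, rfl⟩ := h
  obtain ⟨r', hr', h1, h2, h3, h4, -⟩ := table_swap r hr
  exact ⟨r', hr', h1, h2, h3, h4⟩

theorem claimedDim_swap (n d e m : ℕ) : claimedDim n d e m = claimedDim n e d m := by
  by_cases h : InTable n d e m
  · obtain ⟨r, hr, rfl, rfl, rfl, rfl⟩ := h
    obtain ⟨r', hr', h1, h2, h3, h4, h5⟩ := table_swap r hr
    rw [claimedDim_of_mem hr, ← h5, ← claimedDim_of_mem hr', h1, h2, h3, h4]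
  · rw [claimedDim_of_not_inTable h, claimedDim_of_not_inTable fun h' => h h'.swap, expectedDim,
      expectedDim, numParameters, numParameters, add_comm ((d + n).choose n)]

theorem lowerCheck_eq_true {n d e m : ℕ} (hn : 1 ≤ n) (hn5 : n ≤ 5) (hm : m ≤ 12 - n) (hdm : d < m)
    (hed : e ≤ d) : lowerCheck n d e m = true := by
  exact of_allBelow (lowerCheckAll_eq_true hn hn5 hm hdm) (Nat.lt_succ_of_le hed)

theorem claimedDim_add_one_le_trdeg_of_le {n d e m : ℕ} (hn : 1 ≤ n) (hn5 : n ≤ 5)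
    (hm : m ≤ 12 - n) (hdm : d < m) (hed : e ≤ d) :
    ((claimedDim n d e m + 1 : ℕ) : Cardinal) ≤ Algebra.trdeg ℂ (coneAlgebra n d e m) := by
  obtain ⟨s, hs⟩ := exists_of_anyBelow (lowerCheck_eq_true hn hn5 hm hdm hed)
  have hs' := Nat.le_of_ble_eq_true hs
  obtain ⟨p, hp⟩ := exists_lowerRank_le_finrank n d e m
    (if d + 1 = m then 0 else (m + 1) ^ (n - 1)) (Nat.sub 7 s)
  refine le_trans (Nat.cast_le.2 ?_) (le_trdeg_of_finrank hdm.le p hp)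
  have hc := card_coeffIdx_add_one n d
  refine hs'.trans (le_of_eq ?_)
  rw [Nat.add_eq, ← hc]
  omega

theorem claimedDim_le_ambientDim {n d e m : ℕ} (h : m ≤ d) : claimedDim n d e m ≤ ambientDim n m := by
  rw [claimedDim_of_not_inTable]
  · exact min_le_right _ _
  · rintro ⟨r, hr, rfl, rfl, rfl, rfl⟩
    have := table_bounds r hr
    omega

theorem claimedDim_add_one_le_trdeg_of_le_numerator {n d e m : ℕ} (h : m ≤ d) :
    ((claimedDim n d e m + 1 : ℕ) : Cardinal) ≤ Algebra.trdeg ℂ (coneAlgebra n d e m) := by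
  refine le_trans (Nat.cast_le.2 ?_) (choose_le_trdeg_of_le h)
  have h1 : 0 < (m + n).choose n := Nat.choose_pos (Nat.le_add_left n m)
  have h2 := claimedDim_le_ambientDim (n := n) (e := e) h
  rw [ambientDim] at h2
  omega

theorem claimedDim_add_one_le_trdeg {n d e m : ℕ} (hn : 1 ≤ n) (hn5 : n ≤ 5) (hm : m ≤ 12 - n) :
    ((claimedDim n d e m + 1 : ℕ) : Cardinal) ≤ Algebra.trdeg ℂ (coneAlgebra n d e m) := by
  wlog hed : e ≤ d generalizing d e
  · rw [claimedDim_swap, trdeg_coneAlgebra_swap]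
    exact this (le_of_not_ge hed)
  rcases lt_or_ge d m with hdm | hdm
  · exact claimedDim_add_one_le_trdeg_of_le hn hn5 hm hdm hed
  · exact claimedDim_add_one_le_trdeg_of_le_numerator hdm

theorem exists_trdeg_eq (n d e m : ℕ) :
    ∃ t : ℕ, Algebra.trdeg ℂ (coneAlgebra n d e m) = (t : Cardinal) := by
  have h : Algebra.trdeg ℂ (coneAlgebra n d e m) ≤ Algebra.trdeg ℂ (ConeRing n d e) := by
    rw [← trdeg_subalgebra_add_eq (coneAlgebra n d e m)]
    exact self_le_add_right _ _
  rw [trdeg_coneRing] at h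
  obtain ⟨t, ht⟩ := Cardinal.lt_aleph0.1 (h.trans_lt (Cardinal.natCast_lt_aleph0))
  exact ⟨t, ht⟩

theorem le_projectiveDim {n d e m k : ℕ}
    (h : ((k + 1 : ℕ) : Cardinal) ≤ Algebra.trdeg ℂ (coneAlgebra n d e m)) :
    ((k : ℕ) : WithBot ℕ∞) ≤ projectiveDim (taylorVariety n d e m) := by
  obtain ⟨t, ht⟩ := exists_trdeg_eq n d e m
  rw [ht, Nat.cast_le] at h
  obtain ⟨r, rfl⟩ : ∃ r, t = r + 1 := ⟨t - 1, by omega⟩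
  rw [projectiveDim_taylorVariety ht]
  exact_mod_cast Nat.le_of_succ_le_succ h

theorem trdeg_le_of_add_le {n d e m q k : ℕ}
    (h : Algebra.trdeg ℂ (coneAlgebra n d e m) + (q : ℕ) ≤
      (Nat.card (CoeffIdx n d) + Nat.card (CoeffIdx n e) + 1 : ℕ))
    (hk : numParameters n d e ≤ k + q) :
    Algebra.trdeg ℂ (coneAlgebra n d e m) ≤ (k + 1 : ℕ) := by
  obtain ⟨t, ht⟩ := exists_trdeg_eq n d e m
  rw [ht, ← Nat.cast_add, Nat.cast_le] at h
  rw [ht, Nat.cast_le]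
  rw [numParameters, ← card_coeffIdx_add_one, ← card_coeffIdx_add_one] at hk
  omega

theorem trdeg_le_of_mem_table {r : Row} (hr : r ∈ table) :
    Algebra.trdeg ℂ (coneAlgebra r.n r.d r.e r.m) ≤ (r.dim + 1 : ℕ) := by
  have key : ∀ r ∈ table, r.e ≤ r.d →
      Algebra.trdeg ℂ (coneAlgebra r.n r.d r.e r.m) ≤ (r.dim + 1 : ℕ) := by
    intro r hr hed
    have hp := table_numParameters r hr
    rcases table_order r hr hed with h | ⟨h1, h2, h3, h4, h5⟩
    · have hc := List.all_eq_true.1 upperCheck_table r hr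
      have hg : (Nat.ble r.e r.d && Nat.beq (r.d + 1) r.m) = true := by
        rw [Bool.and_eq_true]
        exact ⟨Nat.ble_eq_true_of_le hed, by rw [h]; exact Nat.beq_refl _⟩
      rw [hg, Bool.not_true, Bool.false_or] at hc
      have hc' := Nat.le_of_ble_eq_true hc
      have hup := trdeg_add_koszulRank_le (n := r.n) (e := r.e) (m := r.m) (by omega)
        ((r.m + 1) ^ (r.n - 1))
      rw [show r.m - 1 = r.d by omega] at hup
      exact trdeg_le_of_add_le hup (hp ▸ hc')
    · have hup := trdeg_coneAlgebra_six_six_eight_add_one_le (n := r.n) (by omega)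
      rw [h2, h3, h4, h5]
      refine trdeg_le_of_add_le hup ?_
      rw [h1]
      -- The 418 parameters minus the one direction leave 417.
      decide +kernel
  rcases le_total r.e r.d with h | h
  · exact key r hr h
  · obtain ⟨r', hr', h1, h2, h3, h4, h5⟩ := table_swap r hr
    have := key r' hr' (by omega)
    rwa [h1, h2, h3, h4, h5, trdeg_coneAlgebra_swap] at this

theorem projectiveDim_of_mem_table {r : Row} (hr : r ∈ table) :
    projectiveDim (taylorVariety r.n r.d r.e r.m) = ((r.dim : ℕ) : WithBot ℕ∞) := by
  obtain ⟨h1, h2, -, -, h3⟩ := table_bounds r hr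
  refine projectiveDim_taylorVariety (le_antisymm (trdeg_le_of_mem_table hr) ?_)
  have := claimedDim_add_one_le_trdeg (d := r.d) (e := r.e) h1 h2 h3
  rwa [claimedDim_of_mem hr] at this

/-- Outside the table the lower bound reaches the expected dimension, which excludes a defect
without any upper bound; for a row of the table the exact dimension is known and smaller than
expected. -/
theorem isDefective_iff_inTable {n d e m : ℕ} (hn : 1 ≤ n) (hn5 : n ≤ 5) (hm : m ≤ 12 - n) :
    IsDefective n d e m ↔ InTable n d e m := by
  constructor
  · intro h
    by_contra hT
    have h1 := le_projectiveDim (claimedDim_add_one_le_trdeg (d := d) (e := e) hn hn5 hm)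
    rw [claimedDim_of_not_inTable hT] at h1
    exact absurd h (not_lt.2 h1)
  · rintro ⟨r, hr, rfl, rfl, rfl, rfl⟩
    rw [IsDefective, projectiveDim_of_mem_table hr, expectedDim, table_numParameters r hr,
      table_ambientDim r hr]
    exact_mod_cast table_dim_lt r hr

theorem ncard_isDefective {n : ℕ} (hn : 1 ≤ n) (hn5 : n ≤ 5) :
    {t : ℕ × ℕ × ℕ | t.2.2 ≤ 12 - n ∧ IsDefective n t.1 t.2.1 t.2.2}.ncard =
      (((table.filter fun r => r.n = n).map fun r => (r.d, r.e, r.m)).toFinset).card := by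
  rw [← Set.ncard_coe_finset]
  congr 1
  ext ⟨d, e, m⟩
  simp only [Set.mem_ofPred_eq, List.coe_toFinset, List.mem_map, List.mem_filter,
    decide_eq_true_eq, Prod.mk.injEq]
  constructor
  · rintro ⟨hm, h⟩
    obtain ⟨r, hr, h1, h2, h3, h4⟩ := (isDefective_iff_inTable hn hn5 hm).1 h
    exact ⟨r, ⟨hr, h1⟩, h2, h3, h4⟩
  · rintro ⟨r, ⟨hr, h1⟩, h2, h3, h4⟩
    have hm : m ≤ 12 - n := by
      have := table_bounds r hr
      omega
    exact ⟨hm, (isDefective_iff_inTable hn hn5 hm).2 ⟨r, hr, h1, h2, h3, h4⟩⟩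

end TaylorVariety

theorem proposition5p3 :
    -- the table lists exactly the defective cases in the range
    (∀ n d e m : ℕ, 1 ≤ n → n ≤ 5 → m ≤ 12 - n →
      (TaylorVariety.IsDefective n d e m ↔
        ∃ r ∈ TaylorVariety.table, r.n = n ∧ r.d = d ∧ r.e = e ∧ r.m = m)) ∧
    -- the three dimensions displayed in each row are correct
    (∀ r ∈ TaylorVariety.table,
      TaylorVariety.projectiveDim (TaylorVariety.taylorVariety r.n r.d r.e r.m)
          = ((r.dim : ℕ) : WithBot ℕ∞) ∧
        TaylorVariety.numParameters r.n r.d r.e = r.params ∧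
        TaylorVariety.ambientDim r.n r.m = r.ambient) ∧
    -- the number of defective cases in the range, for `n = 3, 4, 5`
    {t : ℕ × ℕ × ℕ | t.2.2 ≤ 9 ∧ TaylorVariety.IsDefective 3 t.1 t.2.1 t.2.2}.ncard = 7 ∧
    {t : ℕ × ℕ × ℕ | t.2.2 ≤ 8 ∧ TaylorVariety.IsDefective 4 t.1 t.2.1 t.2.2}.ncard = 14 ∧
    {t : ℕ × ℕ × ℕ | t.2.2 ≤ 7 ∧ TaylorVariety.IsDefective 5 t.1 t.2.1 t.2.2}.ncard = 13 ∧
    -- no defective case for `n = 2`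
    (∀ d e m : ℕ, m ≤ 10 → ¬ TaylorVariety.IsDefective 2 d e m) := by
  refine ⟨fun n d e m hn hn5 hm => TaylorVariety.isDefective_iff_inTable hn hn5 hm, fun r hr =>
    ⟨TaylorVariety.projectiveDim_of_mem_table hr, TaylorVariety.table_numParameters r hr,
      TaylorVariety.table_ambientDim r hr⟩, ?_, ?_, ?_, fun d e m hm h => ?_⟩
  · rw [show (9 : ℕ) = 12 - 3 from rfl, TaylorVariety.ncard_isDefective (by norm_num) (by norm_num)]
    decide +kernel
  · rw [show (8 : ℕ) = 12 - 4 from rfl, TaylorVariety.ncard_isDefective (by norm_num) (by norm_num)]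
    decide +kernel
  · rw [show (7 : ℕ) = 12 - 5 from rfl, TaylorVariety.ncard_isDefective (by norm_num) (by norm_num)]
    decide +kernel
  · obtain ⟨r, hr, h2, -⟩ :=
      (TaylorVariety.isDefective_iff_inTable (by norm_num) (by norm_num) hm).1 h
    have h3 : ∀ r ∈ TaylorVariety.table, r.n ≠ 2 := by decide +kernel
    exact h3 r hr h2
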